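/- For integers $d>0$ and $b>d$ let $$K(b,d)=\sum_{m}\frac1m ,$$ where $m$ runs over the positive integers whose base-$b$ representation does not contain the digit $d$. These series converge. For each fixed integer $d>0$, as the integer $b$ tends to infinity, $K(b,d)-\bigl(b\log b-b\log(1+\tfrac1d)\bigr)$ has an asymptotic expansion to all orders in inverse powers of $b$: there are real numbers $a_1(d),a_2(d),a_3(d),\dots$ such that for every $N\ge 0$ $$K(b,d)=b\log b-b\log\Bigl(1+\frac1d\Bigr)+\sum_{i=1}^{N}\frac{a_i(d)}{b^i}+O\bigl(b^{-N-1}\bigr)\qquad(b\to\infty),$$ where the implied constant may depend on $d$ and $N$. The first five coefficients are \begin{align*} a_1(d) &= (d+\tfrac12)\bigl(\zeta(2)-d^{-2}\bigr),\\ a_2(d) &= -(d^2+d+\tfrac13)\zeta(3)+\frac{9d^2+8d+2}{6d^3(d+1)},\\ a_3(d) &= (d+\tfrac12)(d^2+d+\tfrac12)\zeta(4)-(d+\tfrac12)\zeta(2)-(d+\tfrac12)\frac{2d^4+6d^3+6d^2+4d+1}{2d^4(d+1)^2},\\ a_4(d) &= -(d^4+2d^3+2d^2+d+\tfrac15)\zeta(5)+(2d+1)d\,\zeta(3)-(d+\tfrac12)\zeta(2)\\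 &\quad+\frac{60d^7+240d^6+500d^5+705d^4+627d^3+331d^2+96d+12}{60d^5(d+1)^3},\\ a_5(d) &= (d+\tfrac12)(d^2+d+1)(d^2+d+\tfrac13)\zeta(6)-3(d+\tfrac12)d^2\zeta(4)+(3d^2+3d+\tfrac56)\zeta(3)\\ &\quad-(d+\tfrac12)\frac{9d^6+38d^5+56d^4+44d^3+22d^2+7d+1}{3d^6(d+1)^3}. \end{align*} -/

import Mathlib

open Filter Asymptotics

noncomputable section

/-- The set of positive integers whose base-`b` representation does not contain the digit `d`. -/
def kempnerSet (b d : ℕ) : Set ℕ :=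
  {m : ℕ | 0 < m ∧ d ∉ Nat.digits b m}

/-- The Kempner harmonic sum `K(b,d)`: the sum of the reciprocals of the positive integers
whose base-`b` representation does not contain the digit `d`. -/
def kempnerSum (b d : ℕ) : ℝ :=
  ∑' m : kempnerSet b d, 1 / ((m : ℕ) : ℝ)

/-- The (real) value of the Riemann zeta function at the integer `n`. -/
def zetaValue (n : ℕ) : ℝ :=
  (riemannZeta (n : ℂ)).re

/-- As the integer `b` tends to infinity, `f b` has the asymptotic expansion to all orders
`a 1 / b + a 2 / b ^ 2 + a 3 / b ^ 3 + ⋯`: for every `N`, the difference of `f b` and the sum of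
the terms up to `a N / b ^ N` is `O(b ^ (-(N + 1)))`. -/
def HasInversePowerExpansion (f : ℕ → ℝ) (a : ℕ → ℝ) : Prop :=
  ∀ N : ℕ,
    (fun b : ℕ => f b - ∑ i ∈ Finset.Icc 1 N, a i / (b : ℝ) ^ i)
      =O[atTop] (fun b : ℕ => 1 / (b : ℝ) ^ (N + 1))

end

/-! Write Q for `digitAverage` and E for `kempnerMean`, the normalized sum of the iterates Q^l at 0.
An integer with leading digit a followed by l further digits is b^l (a + x) with x = 0.x₁…x_l, so
its reciprocal is b^(-l)/(a + x). Summing over all admissible strings gives K(b,d) = b E[H], where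
H(x) = Σ 1/(a + x) over nonzero digits a ≠ d (`kempnerSum_eq`).

Splitting off the empty string gives the invariance b E[f] = f(0) + b E[Qf]
(`BddByOn.mul_kempnerMean`), which is used twice.

Applied to H, it replaces H by QH, a sum of 1/(n + x) over b ≤ n < b² without the block db ≤ n < db
+ b, minus H((d + x)/b)/b (`digitAverage_digitKernel`). A local Euler-Maclaurin formula
(`abs_sub_bernoulli_expansion_le`) expands the sums over n in the Bernoulli polynomials B_k(x). The
k = 0 term yields b log b - b log(1 + 1/d). Expanding H((d + x)/b) geometrically, the leading term
cancels H(0). What remains involves only E[B_k], E[(d + x)^j] and truncated zeta sums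
(`kempnerSum_formula`).

Applied to B_k, the multiplication theorem says that averaging over all b digits scales B_k by
b^(-k). Deleting the digit d therefore gives a recursion for E[B_k] in which every term on the right
carries a positive power of 1/b (`kempnerMean_bernoulliFun`). Iterating it expands all E[B_k], hence
all moments, to every order (`expands_bernoulliFun`). The zeta sums expand by Euler-Maclaurin again
(`digitZeta_eqMod`).

Expansions in 1/b are unique, so these identities become identities of formal power series, and a
triangular recursion on coefficients gives a_1, …, a_5. -/

/-! ### The digit-averaging operator and the mean it defines. -/

/-- The average of `f` over the points `(a + x) / b`, `a` running over the base-`b` digits other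
than `d`; normalized by `b`, so that its mass is `(b - 1) / b`. -/
noncomputable def digitAverage (b d : ℕ) (f : ℝ → ℝ) (x : ℝ) : ℝ :=
  (∑ a ∈ (Finset.range b).erase d, f ((a + x) / b)) / b

/-- The normalized integral of `f` against the measure which gives mass `b ^ (-l)` to `0.x₁…x_l`
for every string of `l` digits other than `d`. -/
noncomputable def kempnerMean (b d : ℕ) (f : ℝ → ℝ) : ℝ :=
  (∑' l : ℕ, (digitAverage b d)^[l] f 0) / b

/-- `|f| ≤ C` on the unit interval. -/
def BddByOn (C : ℝ) (f : ℝ → ℝ) : Prop := ∀ x ∈ Set.Icc (0 : ℝ) 1, |f x| ≤ C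

lemma digit_point_mem {b a : ℕ} (ha : a < b) {x : ℝ} (hx : x ∈ Set.Icc (0 : ℝ) 1) :
    (a + x) / b ∈ Set.Icc (0 : ℝ) 1 := by
  have hb : (0 : ℝ) < b := by exact_mod_cast (Nat.zero_le a).trans_lt ha
  have h1 : (a : ℝ) + 1 ≤ b := by exact_mod_cast ha
  have h0 : (0 : ℝ) ≤ a := Nat.cast_nonneg a
  exact ⟨div_nonneg (add_nonneg h0 hx.1) hb.le, (div_le_one hb).2 (by linarith [hx.2])⟩

lemma BddByOn.digitAverage {b d : ℕ} (hd : d < b) {C : ℝ} {f : ℝ → ℝ} (hf : BddByOn C f) :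
    BddByOn (((b : ℝ) - 1) / b * C) (digitAverage b d f) := by
  intro x hx
  have hb : (0 : ℝ) < b := by exact_mod_cast (Nat.zero_le d).trans_lt hd
  have h1 : |∑ a ∈ (Finset.range b).erase d, f ((a + x) / b)| ≤ ((b : ℝ) - 1) * C := by
    calc _ ≤ ∑ a ∈ (Finset.range b).erase d, |f ((a + x) / b)| := Finset.abs_sum_le_sum_abs _ _
      _ ≤ ∑ a ∈ (Finset.range b).erase d, C := Finset.sum_le_sum fun a ha =>
          hf _ (digit_point_mem (Finset.mem_range.1 (Finset.mem_of_mem_erase ha)) hx)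
      _ = ((b : ℝ) - 1) * C := by
          rw [Finset.sum_const, Finset.card_erase_of_mem (Finset.mem_range.2 hd),
            Finset.card_range, nsmul_eq_mul, Nat.cast_sub (by omega), Nat.cast_one]
  rw [_root_.digitAverage, abs_div, abs_of_pos hb, div_mul_eq_mul_div]
  gcongr

lemma BddByOn.iterate_digitAverage {b d : ℕ} (hd : d < b) {C : ℝ} {f : ℝ → ℝ}
    (hf : BddByOn C f) (l : ℕ) :
    BddByOn ((((b : ℝ) - 1) / b) ^ l * C) ((_root_.digitAverage b d)^[l] f) := by
  induction l with
  | zero => simpa using hf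
  | succ l ih =>
    rw [Function.iterate_succ_apply', pow_succ', mul_assoc]
    exact ih.digitAverage hd

/-- The total mass is b, which is why `kempnerMean` divides by b; this series also dominates the
iterates of every bounded function. -/
lemma hasSum_digit_geometric {b : ℕ} (hb : 0 < b) :
    HasSum (fun l : ℕ => (((b : ℝ) - 1) / b) ^ l) b := by
  have hb' : (1 : ℝ) ≤ b := by exact_mod_cast hb
  have h := hasSum_geometric_of_lt_one (r := ((b : ℝ) - 1) / b)
    (div_nonneg (by linarith) (by linarith)) ((div_lt_one (by linarith)).2 (by linarith))
  convert h using 1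
  have : (b : ℝ) ≠ 0 := by linarith
  field_simp
  ring

lemma BddByOn.abs_iterate_le {b d : ℕ} (hd : d < b) {C : ℝ} {f : ℝ → ℝ} (hf : BddByOn C f)
    (l : ℕ) : |(_root_.digitAverage b d)^[l] f 0| ≤ (((b : ℝ) - 1) / b) ^ l * C :=
  hf.iterate_digitAverage hd l 0 ⟨le_rfl, zero_le_one⟩

lemma BddByOn.summable_iterate {b d : ℕ} (hd : d < b) {C : ℝ} {f : ℝ → ℝ} (hf : BddByOn C f) :
    Summable fun l : ℕ => (_root_.digitAverage b d)^[l] f 0 :=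
  ((hasSum_digit_geometric (by omega : 0 < b)).mul_right C).summable.of_norm_bounded
    fun l => (Real.norm_eq_abs _).trans_le (hf.abs_iterate_le hd l)

lemma BddByOn.abs_kempnerMean_le {b d : ℕ} (hd : d < b) {C : ℝ} {f : ℝ → ℝ} (hf : BddByOn C f) :
    |kempnerMean b d f| ≤ C := by
  have hb : (0 : ℝ) < b := by exact_mod_cast (Nat.zero_le d).trans_lt hd
  rw [kempnerMean, abs_div, abs_of_pos hb, div_le_iff₀ hb, mul_comm]
  rw [← Real.norm_eq_abs]
  exact tsum_of_norm_bounded (f := fun l => (_root_.digitAverage b d)^[l] f 0)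
    ((hasSum_digit_geometric (by omega : 0 < b)).mul_right C) fun l => hf.abs_iterate_le hd l

/-- The term l = 0 of the defining series is f(0), and the remaining terms are the series of the
averaged function. -/
lemma BddByOn.mul_kempnerMean {b d : ℕ} (hd : d < b) {C : ℝ} {f : ℝ → ℝ} (hf : BddByOn C f) :
    b * kempnerMean b d f = f 0 + b * kempnerMean b d (_root_.digitAverage b d f) := by
  have hb : (b : ℝ) ≠ 0 := by exact_mod_cast (by omega : b ≠ 0)
  rw [kempnerMean, kempnerMean, mul_div_cancel₀ _ hb, mul_div_cancel₀ _ hb,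
    (hf.summable_iterate hd).tsum_eq_zero_add]
  simp only [Function.iterate_succ_apply, Function.iterate_zero, id]

lemma iterate_digitAverage_lincomb {ι : Type*} (b d l : ℕ) (s : Finset ι) (c : ι → ℝ)
    (f : ι → ℝ → ℝ) :
    (digitAverage b d)^[l] (fun x => ∑ i ∈ s, c i * f i x)
      = fun x => ∑ i ∈ s, c i * (digitAverage b d)^[l] (f i) x := by
  induction l with
  | zero => rfl
  | succ l ih =>
    simp only [Function.iterate_succ_apply', ih]
    funext x
    simp only [digitAverage, Finset.mul_sum, Finset.sum_div]
    rw [Finset.sum_comm]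
    simp only [mul_div_assoc]

lemma kempnerMean_lincomb {ι : Type*} {b d : ℕ} (hd : d < b) (s : Finset ι) (c : ι → ℝ)
    {f : ι → ℝ → ℝ} (hf : ∀ i ∈ s, ∃ C, BddByOn C (f i)) :
    kempnerMean b d (fun x => ∑ i ∈ s, c i * f i x) = ∑ i ∈ s, c i * kempnerMean b d (f i) := by
  simp only [kempnerMean, iterate_digitAverage_lincomb]
  rw [Summable.tsum_finsetSum, Finset.sum_div]
  · simp only [tsum_mul_left, mul_div_assoc]
  · intro i hi
    obtain ⟨C, hC⟩ := hf i hi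
    exact (hC.summable_iterate hd).mul_left _

lemma kempnerMean_add {b d : ℕ} (hd : d < b) {f g : ℝ → ℝ} {C C' : ℝ} (hf : BddByOn C f)
    (hg : BddByOn C' g) :
    kempnerMean b d (fun x => f x + g x) = kempnerMean b d f + kempnerMean b d g := by
  have := kempnerMean_lincomb hd Finset.univ (fun _ : Bool => (1 : ℝ))
    (f := fun i => cond i f g) (by rintro (_ | _) -; exacts [⟨_, hg⟩, ⟨_, hf⟩])
  simpa using this

lemma kempnerMean_const_mul {b d : ℕ} (hd : d < b) {f : ℝ → ℝ} {C : ℝ} (c : ℝ)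
    (hf : BddByOn C f) :
    kempnerMean b d (fun x => c * f x) = c * kempnerMean b d f := by
  have := kempnerMean_lincomb hd Finset.univ (fun _ : Unit => c)
    (f := fun _ => f) (fun _ _ => ⟨_, hf⟩)
  simpa using this

/-- The invariance for f = 1 reads b E[1] = 1 + (b - 1) E[1]. -/
lemma kempnerMean_one {b d : ℕ} (hd : d < b) : kempnerMean b d (fun _ => 1) = 1 := by
  have hb : (b : ℝ) ≠ 0 := by exact_mod_cast (by omega : b ≠ 0)
  have h1 : BddByOn 1 (fun _ => (1 : ℝ)) := fun x _ => by simp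
  have h2 : digitAverage b d (fun _ => (1 : ℝ)) = fun _ => (((b : ℝ) - 1) / b) * 1 := by
    funext x
    rw [digitAverage, Finset.sum_const, Finset.card_erase_of_mem (Finset.mem_range.2 hd),
      Finset.card_range, nsmul_eq_mul, Nat.cast_sub (by omega), Nat.cast_one]
    ring
  have h3 := h1.mul_kempnerMean hd
  rw [h2, kempnerMean_const_mul hd _ h1] at h3
  field_simp at h3
  linarith

lemma BddByOn.of_continuousOn {f : ℝ → ℝ} (hf : ContinuousOn f (Set.Icc 0 1)) :
    ∃ C, BddByOn C f := by
  obtain ⟨C, hC⟩ := isCompact_Icc.exists_bound_of_continuousOn hf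
  exact ⟨C, hC⟩

/-! The Kempner sum as an integral against this measure. -/

/-- The integers with exactly `l + 1` base-`b` digits, none of which is `d`. -/
def kempnerBlock (b d l : ℕ) : Finset ℕ :=
  (Finset.Ico (b ^ l) (b ^ (l + 1))).filter fun m => d ∉ Nat.digits b m

lemma notMem_digits_mul_add {b d m a : ℕ} (hb : 1 < b) (ha : a < b) (hm : 0 < m) :
    d ∉ Nat.digits b (b * m + a) ↔ d ≠ a ∧ d ∉ Nat.digits b m := by
  rw [add_comm, Nat.digits_add b hb a m ha (Or.inr hm.ne'), List.mem_cons, not_or]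

/-- Euclidean division by b strips the last digit. The quotient is positive, so the digit condition
splits into one on the quotient and one on the remainder. -/
lemma sum_kempnerBlock_succ {b d : ℕ} (hb : 1 < b) (l : ℕ) (g : ℕ → ℝ) :
    ∑ m ∈ kempnerBlock b d (l + 1), g m
      = ∑ m ∈ kempnerBlock b d l, ∑ a ∈ (Finset.range b).erase d, g (b * m + a) := by
  have hb0 : 0 < b := by omega
  rw [← Finset.sum_product']
  symm
  refine Finset.sum_bij' (fun p _ => b * p.1 + p.2) (fun n _ => (n / b, n % b)) ?_ ?_ ?_ ?_ ?_
  · rintro ⟨m, a⟩ h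
    simp only [Finset.mem_product, kempnerBlock, Finset.mem_filter, Finset.mem_Ico,
      Finset.mem_erase, Finset.mem_range] at h ⊢
    obtain ⟨⟨⟨h1, h2⟩, h3⟩, h4, h5⟩ := h
    have hm : 0 < m := lt_of_lt_of_le (by positivity) h1
    refine ⟨⟨?_, ?_⟩, (notMem_digits_mul_add hb h5 hm).2 ⟨h4.symm, h3⟩⟩
    · calc b ^ (l + 1) = b * b ^ l := pow_succ' b l
        _ ≤ b * m := Nat.mul_le_mul_left _ h1
        _ ≤ _ := Nat.le_add_right _ _
    · calc b * m + a < b * m + b := by omega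
        _ = b * (m + 1) := by ring
        _ ≤ b * b ^ (l + 1) := Nat.mul_le_mul_left _ h2
        _ = _ := (pow_succ' b (l + 1)).symm
  · intro n h
    simp only [Finset.mem_product, kempnerBlock, Finset.mem_filter, Finset.mem_Ico,
      Finset.mem_erase, Finset.mem_range] at h ⊢
    obtain ⟨⟨h1, h2⟩, h3⟩ := h
    have hq : b ^ l ≤ n / b := (Nat.le_div_iff_mul_le hb0).2 (by rwa [← pow_succ])
    have hq' : n / b < b ^ (l + 1) := Nat.div_lt_of_lt_mul (by rwa [← pow_succ'])
    have hm : 0 < n / b := lt_of_lt_of_le (by positivity) hq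
    rw [← Nat.div_add_mod n b, notMem_digits_mul_add hb (Nat.mod_lt _ hb0) hm] at h3
    exact ⟨⟨⟨hq, hq'⟩, h3.2⟩, h3.1.symm, Nat.mod_lt _ hb0⟩
  · rintro ⟨m, a⟩ h
    simp only [Finset.mem_product, Finset.mem_erase, Finset.mem_range] at h
    simp [Nat.mul_add_div hb0, Nat.div_eq_of_lt h.2.2, Nat.mod_eq_of_lt h.2.2]
  · intro n _
    exact Nat.div_add_mod n b
  · intro p _
    rfl

/-- The sum of `1 / (a + x)` over the nonzero digits `a ≠ d`. -/
noncomputable def digitKernel (b d : ℕ) (x : ℝ) : ℝ :=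
  ∑ a ∈ (Finset.Ico 1 b).erase d, 1 / ((a : ℝ) + x)

lemma kempnerBlock_zero {b d : ℕ} : kempnerBlock b d 0 = (Finset.Ico 1 b).erase d := by
  ext m
  simp only [kempnerBlock, Finset.mem_filter, Finset.mem_Ico, Finset.mem_erase, pow_zero,
    zero_add, pow_one]
  constructor
  · rintro ⟨⟨h1, h2⟩, h3⟩
    rw [Nat.digits_of_lt b m (by omega) h2] at h3
    exact ⟨fun h => h3 (by simp [h]), h1, h2⟩
  · rintro ⟨h3, h1, h2⟩
    rw [Nat.digits_of_lt b m (by omega) h2]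
    exact ⟨⟨h1, h2⟩, by simpa using Ne.symm h3⟩

/-- Since (1/b) / (m + (a + x)/b) = 1/(bm + a + x), one averaging step appends a last digit a to
every m. -/
lemma iterate_digitAverage_digitKernel {b d : ℕ} (hb : 1 < b) (l : ℕ) :
    (digitAverage b d)^[l] (digitKernel b d)
      = fun x => ∑ m ∈ kempnerBlock b d l, 1 / ((m : ℝ) + x) := by
  have hb0 : (b : ℝ) ≠ 0 := by exact_mod_cast (by omega : b ≠ 0)
  induction l with
  | zero => rw [kempnerBlock_zero]; rfl
  | succ l ih =>
    rw [Function.iterate_succ_apply', ih]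
    funext x
    rw [sum_kempnerBlock_succ hb l (fun m => 1 / ((m : ℝ) + x)), digitAverage, Finset.sum_comm,
      Finset.sum_div]
    refine Finset.sum_congr rfl fun m _ => ?_
    rw [Finset.sum_div]
    refine Finset.sum_congr rfl fun a _ => ?_
    push_cast
    rw [div_div, add_mul, div_mul_cancel₀ _ hb0]
    congr 1
    ring

lemma digitKernel_bdd (b d : ℕ) : BddByOn b (digitKernel b d) := by
  intro x hx
  have h : ∀ a ∈ (Finset.Ico 1 b).erase d, 0 ≤ 1 / ((a : ℝ) + x) ∧ 1 / ((a : ℝ) + x) ≤ 1 := by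
    intro a ha
    have h1 : (1 : ℝ) ≤ a := by
      exact_mod_cast (Finset.mem_Ico.1 (Finset.mem_of_mem_erase ha)).1
    have h2 : 1 ≤ (a : ℝ) + x := by linarith [hx.1]
    exact ⟨by positivity, (div_le_one (by linarith)).2 h2⟩
  rw [digitKernel, abs_of_nonneg (Finset.sum_nonneg fun a ha => (h a ha).1)]
  calc _ ≤ ∑ a ∈ (Finset.Ico 1 b).erase d, (1 : ℝ) := Finset.sum_le_sum fun a ha => (h a ha).2
    _ ≤ b := by
      rw [Finset.sum_const, nsmul_eq_mul, mul_one]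
      exact_mod_cast (Finset.card_le_card (Finset.erase_subset _ _)).trans (by simp)

lemma hasSum_kempner {b d : ℕ} (hd : 0 < d) (hdb : d < b) :
    HasSum (fun m : kempnerSet b d => 1 / ((m : ℕ) : ℝ))
      (b * kempnerMean b d (digitKernel b d)) := by
  have hb : 1 < b := by omega
  have hb0 : (b : ℝ) ≠ 0 := by exact_mod_cast (by omega : b ≠ 0)
  set g : ℕ → ℝ := (kempnerSet b d).indicator fun m => 1 / (m : ℝ) with hg
  have hg0 : ∀ m, 0 ≤ g m := fun m => Set.indicator_nonneg (fun _ _ => by positivity) m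
  suffices h : HasSum g (b * kempnerMean b d (digitKernel b d)) from
    (hasSum_subtype_iff_indicator (f := fun m : ℕ => 1 / (m : ℝ))).2 h
  have hblock : ∀ l, ∑ m ∈ Finset.Ico (b ^ l) (b ^ (l + 1)), g m
      = (digitAverage b d)^[l] (digitKernel b d) 0 := by
    intro l
    rw [iterate_digitAverage_digitKernel hb, kempnerBlock]
    dsimp only
    rw [Finset.sum_filter]
    refine Finset.sum_congr rfl fun m hm => ?_
    have hm0 : 0 < m := lt_of_lt_of_le (by positivity) (Finset.mem_Ico.1 hm).1
    by_cases h : d ∈ Nat.digits b m <;> simp [hg, kempnerSet, h, hm0]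
  have hpart : ∀ L, ∑ m ∈ Finset.range (b ^ L), g m
      = ∑ l ∈ Finset.range L, (digitAverage b d)^[l] (digitKernel b d) 0 := by
    intro L
    induction L with
    | zero => simp [hg, kempnerSet]
    | succ L ih =>
      rw [Finset.sum_range_succ, ← ih, ← hblock,
        Finset.sum_range_add_sum_Ico _ (Nat.pow_le_pow_right (by omega) (Nat.le_succ L))]
  have hlim : Tendsto (fun L => ∑ m ∈ Finset.range (b ^ L), g m) atTop
      (nhds (b * kempnerMean b d (digitKernel b d))) := by
    simp only [hpart]
    rw [kempnerMean, mul_div_cancel₀ _ hb0]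
    exact ((digitKernel_bdd b d).summable_iterate hdb).hasSum.tendsto_sum_nat
  -- The terms are nonnegative, so partial sums are monotone and the limit along the cutoffs b^L is
  -- enough.
  rw [hasSum_iff_tendsto_nat_of_nonneg hg0]
  exact (tendsto_iff_tendsto_subseq_of_monotone
    (fun m n h => Finset.sum_le_sum_of_subset_of_nonneg (Finset.range_mono h) fun i _ _ => hg0 i)
    (tendsto_pow_atTop_atTop_of_one_lt hb)).2 hlim

lemma kempnerSum_eq {b d : ℕ} (hd : 0 < d) (hdb : d < b) :
    kempnerSum b d = b * kempnerMean b d (digitKernel b d) :=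
  (hasSum_kempner hd hdb).tsum_eq

/-! A local Euler-Maclaurin formula. -/

-- The remainder for the tower F has as derivative the remainder of order one less for the shifted
-- tower, and it vanishes somewhere by Rolle; integrating over an interval of length at most 1
-- preserves the bound. The constant 2C comes from the base case and does not grow with n.
open Nat in
lemma abs_sub_bernoulli_expansion_le (n : ℕ) (F : ℕ → ℝ → ℝ)
    (hF : ∀ k, ∀ x ∈ Set.Icc (0 : ℝ) 1, HasDerivAt (F k) (F (k + 1) x) x) {C : ℝ}
    (hC : BddByOn C (F (n + 1))) :
    BddByOn (2 * C) fun x => F 1 x -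
      ∑ k ∈ Finset.range (n + 1), (F k 1 - F k 0) * (bernoulliFun k x / k !) := by
  induction n generalizing F with
  | zero =>
    intro x hx
    obtain ⟨c, hc, hc'⟩ := exists_hasDerivAt_eq_slope (F 0) (F 1) zero_lt_one
      (fun x hx => (hF 0 x hx).continuousAt.continuousWithinAt)
      (fun x hx => hF 0 x (Set.Ioo_subset_Icc_self hx))
    have h1 := abs_le.1 (hC x hx)
    have h2 := abs_le.1 (hC c (Set.Ioo_subset_Icc_self hc))
    have h3 : F 0 1 - F 0 0 = F 1 c := by rw [hc']; ring
    simp only [zero_add, Finset.range_one, Finset.sum_singleton, bernoulliFun_zero,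
      Nat.factorial_zero, Nat.cast_one, div_one, mul_one, h3] at h1 h2 ⊢
    exact abs_le.2 ⟨by linarith, by linarith⟩
  | succ n ih =>
    set R : ℝ → ℝ := fun x => F 1 x -
      ∑ k ∈ Finset.range (n + 1 + 1), (F k 1 - F k 0) * (bernoulliFun k x / k !) with hR
    set R' : ℝ → ℝ := fun x => F 2 x -
      ∑ k ∈ Finset.range (n + 1), (F (k + 1) 1 - F (k + 1) 0) * (bernoulliFun k x / k !) with hR'
    have hb : BddByOn (2 * C) R' := ih (fun k => F (k + 1)) (fun k => hF (k + 1)) hC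
    have hfac : ∀ k : ℕ, ((k + 1)! : ℝ) = (k + 1) * k ! := fun k => by
      rw [Nat.factorial_succ]; push_cast; ring
    have hpos : ∀ k : ℕ, (k ! : ℝ) ≠ 0 := fun k => by exact_mod_cast Nat.factorial_ne_zero k
    have hderiv : ∀ x ∈ Set.Icc (0 : ℝ) 1, HasDerivAt R (R' x) x := by
      intro x hx
      refine (hF 1 x hx).sub ?_
      have h := HasDerivAt.fun_sum (u := Finset.range (n + 1 + 1)) (x := x)
        (A := fun k x => (F k 1 - F k 0) * (bernoulliFun k x / k !))
        (A' := fun k => (F k 1 - F k 0) * (k * bernoulliFun (k - 1) x / k !))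
        fun k _ => ((hasDerivAt_bernoulliFun k x).div_const _).const_mul _
      convert h using 1
      rw [Finset.sum_range_succ' _ (n + 1)]
      simp only [Nat.cast_zero, zero_mul, zero_div, mul_zero, add_zero, Nat.add_sub_cancel]
      refine Finset.sum_congr rfl fun k _ => ?_
      have := hpos k
      have hk : (k : ℝ) + 1 ≠ 0 := by positivity
      rw [hfac]
      push_cast
      field_simp
    have hA : ∀ x ∈ Set.Icc (0 : ℝ) 1, HasDerivAt (fun x => F 0 x -
        ∑ k ∈ Finset.range (n + 1 + 1), (F k 1 - F k 0) * (bernoulliFun (k + 1) x / (k + 1)!))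
        (R x) x := by
      intro x hx
      refine (hF 0 x hx).sub (HasDerivAt.fun_sum fun k _ => ?_)
      have h := ((hasDerivAt_bernoulliFun (k + 1) x).div_const ((k + 1)! : ℝ)).const_mul
        (F k 1 - F k 0)
      refine h.congr_deriv ?_
      have := hpos k
      have hk : (k : ℝ) + 1 ≠ 0 := by positivity
      rw [hfac]
      push_cast
      field_simp
    -- The antiderivative of R takes equal values at 0 and 1: B_j(1) = B_j(0) except for j = 1,
    -- where the jump 1 balances F 0 1 - F 0 0.
    obtain ⟨ξ, hξ, hξ'⟩ := exists_hasDerivAt_eq_zero (f' := R) zero_lt_one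
      (fun x hx => (hA x hx).continuousAt.continuousWithinAt)
      (by
        simp only [bernoulliFun_eval_one]
        rw [Finset.sum_range_succ' _ (n + 1), Finset.sum_range_succ' _ (n + 1)]
        simp
        ring)
      (fun x hx => hA x (Set.Ioo_subset_Icc_self hx))
    intro x hx
    have hξI := Set.Ioo_subset_Icc_self hξ
    have := (convex_Icc (0 : ℝ) 1).norm_image_sub_le_of_norm_hasDerivWithin_le
      (fun y hy => (hderiv y hy).hasDerivWithinAt) hb hξI hx
    rw [hξ', sub_zero, Real.norm_eq_abs, Real.norm_eq_abs] at this
    have hC0 : 0 ≤ 2 * C := (abs_nonneg _).trans (hb x hx)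
    refine this.trans (mul_le_of_le_one_right hC0 ?_)
    exact abs_le.2 ⟨by linarith [hx.1, hξI.2], by linarith [hx.2, hξI.1]⟩

/-- The successive derivatives of the logarithm. -/
noncomputable def logTower : ℕ → ℝ → ℝ
  | 0, t => Real.log t
  | k + 1, t => (-1) ^ k * k.factorial / t ^ (k + 1)

lemma hasDerivAt_logTower (k : ℕ) {t : ℝ} (ht : 0 < t) :
    HasDerivAt (logTower k) (logTower (k + 1) t) t := by
  cases k with
  | zero => exact (Real.hasDerivAt_log ht.ne').congr_deriv (by simp [logTower])
  | succ k =>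
    have h := ((hasDerivAt_pow (k + 1) t).inv (pow_ne_zero _ ht.ne')).const_mul
      ((-1 : ℝ) ^ k * k.factorial)
    have ht' := ht.ne'
    refine h.congr_deriv ?_
    simp only [logTower, Nat.factorial_succ, Nat.add_sub_cancel]
    push_cast
    field_simp
    ring

lemma abs_logTower_succ_le (k : ℕ) {m x : ℝ} (hm : 0 < m) (hx : 0 ≤ x) :
    |logTower (k + 1) (m + x)| ≤ k.factorial / m ^ (k + 1) := by
  have hmx : 0 < m + x := by linarith
  rw [logTower, abs_div, abs_mul, abs_pow, abs_neg, abs_one, one_pow, one_mul,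
    abs_of_nonneg (by positivity), abs_of_pos (by positivity : 0 < (m + x) ^ (k + 1))]
  gcongr
  linarith

/-- The shift s serves two uses: s = 0 for sums of 1/(m + x), and s ≥ 1 for the tails of the zeta
series. -/
lemma bernoulli_expansion_step (s n : ℕ) {m : ℝ} (hm : 0 < m) :
    BddByOn (2 * ((s + n).factorial / m ^ (s + n + 1))) fun x => logTower (s + 1) (m + x) -
      ∑ k ∈ Finset.range (n + 1), (logTower (s + k) (m + 1) - logTower (s + k) m) *
        (bernoulliFun k x / k.factorial) := by
  have := abs_sub_bernoulli_expansion_le n (fun k x => logTower (s + k) (m + x))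
    (fun k x hx => (hasDerivAt_logTower (s + k) (by linarith [hx.1] : 0 < m + x)).comp_const_add
      m x)
    (C := (s + n).factorial / m ^ (s + n + 1))
    (fun x hx => abs_logTower_succ_le (s + n) hm hx.1)
  simpa using this

/-- Each term is at most 2 (m^(-p) - (m + 1)^(-p)), because (m + 1)^p ≥ m^(p-1) (m + 1) and m + 1 ≤
2m; the bound telescopes. -/
lemma sum_Ico_inv_pow_le {p M N : ℕ} (hp : p ≠ 0) (hM : 0 < M) (hMN : M ≤ N) :
    ∑ m ∈ Finset.Ico M N, 1 / (m : ℝ) ^ (p + 1) ≤ 2 / (M : ℝ) ^ p := by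
  obtain ⟨q, rfl⟩ := Nat.exists_eq_succ_of_ne_zero hp
  have hstep : ∀ m ∈ Finset.Ico M N, 1 / (m : ℝ) ^ (q + 1 + 1)
      ≤ -(2 / ((m + 1 : ℕ) : ℝ) ^ (q + 1)) - -(2 / (m : ℝ) ^ (q + 1)) := by
    intro m hm
    have hm1 : (1 : ℝ) ≤ m := by exact_mod_cast hM.trans_le (Finset.mem_Ico.1 hm).1
    have hm0 : (0 : ℝ) < m := by linarith
    have h1 : 1 / ((m : ℝ) + 1) ^ (q + 1) ≤ 1 / ((m : ℝ) ^ q * (m + 1)) := by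
      rw [pow_succ]
      gcongr
      linarith
    have h2 : 1 / (m : ℝ) ^ (q + 1) - 1 / ((m : ℝ) ^ q * (m + 1))
        = 1 / ((m : ℝ) ^ (q + 1) * (m + 1)) := by
      field_simp
      ring
    have h3 : 1 / (m : ℝ) ^ (q + 1 + 1) ≤ 2 * (1 / ((m : ℝ) ^ (q + 1) * (m + 1))) := by
      rw [mul_one_div, div_le_div_iff₀ (by positivity) (by positivity), pow_succ _ (q + 1)]
      have : 0 < (m : ℝ) ^ (q + 1) := by positivity
      nlinarith
    push_cast
    rw [← mul_one_div 2, ← mul_one_div 2]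
    linarith
  refine (Finset.sum_le_sum hstep).trans ?_
  rw [Finset.sum_Ico_sub (fun m : ℕ => -(2 / (m : ℝ) ^ (q + 1))) hMN]
  have : 0 ≤ 2 / (N : ℝ) ^ (q + 1) := by positivity
  simp only [Nat.succ_eq_add_one]
  linarith

lemma bernoulli_expansion_sum {s n M N : ℕ} (hsn : s + n ≠ 0) (hM : 0 < M) (hMN : M ≤ N) :
    BddByOn (4 * (s + n).factorial / (M : ℝ) ^ (s + n)) fun x =>
      (∑ m ∈ Finset.Ico M N, logTower (s + 1) (m + x)) -
      ∑ k ∈ Finset.range (n + 1), (logTower (s + k) N - logTower (s + k) M) *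
        (bernoulliFun k x / k.factorial) := by
  intro x hx
  have htel : ∀ k, logTower (s + k) N - logTower (s + k) M
      = ∑ m ∈ Finset.Ico M N, (logTower (s + k) ((m : ℝ) + 1) - logTower (s + k) m) := by
    intro k
    rw [← Finset.sum_Ico_sub (fun m : ℕ => logTower (s + k) (m : ℝ)) hMN]
    simp
  simp only [htel, Finset.sum_mul]
  rw [Finset.sum_comm, ← Finset.sum_sub_distrib]
  refine (Finset.abs_sum_le_sum_abs _ _).trans ?_
  calc _ ≤ ∑ m ∈ Finset.Ico M N, 2 * ((s + n).factorial : ℝ) * (1 / (m : ℝ) ^ (s + n + 1)) := by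
        refine Finset.sum_le_sum fun m hm => ?_
        have hm0 : (0 : ℝ) < m := by exact_mod_cast hM.trans_le (Finset.mem_Ico.1 hm).1
        have := bernoulli_expansion_step s n hm0 x hx
        rwa [mul_assoc, mul_one_div]
    _ ≤ 2 * ((s + n).factorial : ℝ) * (2 / (M : ℝ) ^ (s + n)) := by
        rw [← Finset.mul_sum]
        gcongr
        exact sum_Ico_inv_pow_le hsn hM hMN
    _ = _ := by ring

/-! ### Partial sums of zeta values. -/

lemma hasSum_zetaValue {k : ℕ} (hk : 1 < k) :
    HasSum (fun n : ℕ => 1 / (n : ℝ) ^ k) (zetaValue k) := by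
  have h1 : Summable fun n : ℕ => 1 / (n : ℝ) ^ k := Real.summable_one_div_nat_pow.2 hk
  have h2 : zetaValue k = ∑' n : ℕ, 1 / (n : ℝ) ^ k := by
    rw [zetaValue, zeta_nat_eq_tsum_of_gt_one hk, ← Complex.ofReal_re (∑' n : ℕ, 1 / (n : ℝ) ^ k)]
    push_cast
    rfl
  rw [h2]
  exact h1.hasSum

lemma tendsto_logTower_succ (k : ℕ) :
    Tendsto (fun N : ℕ => logTower (k + 1) N) atTop (nhds 0) :=
  tendsto_const_nhds.div_atTop
    ((tendsto_pow_atTop (Nat.succ_ne_zero k)).comp tendsto_natCast_atTop_atTop)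

/-- The asymptotic expansion of the partial sums of the zeta function. -/
lemma abs_zetaValue_sub_sum_le {s M : ℕ} (n : ℕ) (hs : s ≠ 0) (hM : 0 < M) :
    |(-1) ^ s * s.factorial * (zetaValue (s + 1) - ∑ a ∈ Finset.Ico 1 M, 1 / (a : ℝ) ^ (s + 1))
      + ∑ k ∈ Finset.range (n + 1), logTower (s + k) M * (bernoulli k / k.factorial)|
      ≤ 4 * (s + n).factorial / (M : ℝ) ^ (s + n) := by
  -- Take the summed expansion at x = 0 and let N → ∞. As s ≥ 1, the boundary terms at N tend to 0
  -- and only those at M survive.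
  have hlim1 : Tendsto (fun N : ℕ => ∑ m ∈ Finset.Ico M N, logTower (s + 1) (m + 0)) atTop
      (nhds ((-1) ^ s * s.factorial *
        (zetaValue (s + 1) - ∑ a ∈ Finset.Ico 1 M, 1 / (a : ℝ) ^ (s + 1)))) := by
    have h := (((hasSum_zetaValue (by omega : 1 < s + 1)).tendsto_sum_nat).sub_const
      (∑ a ∈ Finset.Ico 1 M, 1 / (a : ℝ) ^ (s + 1))).const_mul ((-1 : ℝ) ^ s * s.factorial)
    refine h.congr' ?_
    filter_upwards [eventually_ge_atTop M] with N hN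
    -- The index a = 0 contributes nothing, division by zero being zero.
    have h0 : ∑ a ∈ Finset.range M, 1 / (a : ℝ) ^ (s + 1)
        = ∑ a ∈ Finset.Ico 1 M, 1 / (a : ℝ) ^ (s + 1) := by
      rw [Finset.range_eq_Ico, Finset.sum_eq_sum_Ico_succ_bot hM]
      simp
    rw [← Finset.sum_range_add_sum_Ico _ hN, h0, add_sub_cancel_left, Finset.mul_sum]
    refine Finset.sum_congr rfl fun m _ => ?_
    rw [logTower, add_zero, mul_one_div]
  have hlim2 : Tendsto (fun N : ℕ => ∑ k ∈ Finset.range (n + 1),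
      (logTower (s + k) N - logTower (s + k) M) * (bernoulliFun k 0 / k.factorial)) atTop
      (nhds (∑ k ∈ Finset.range (n + 1), (0 - logTower (s + k) M) *
        (bernoulliFun k 0 / k.factorial))) := by
    refine tendsto_finsetSum _ fun k _ => (Tendsto.sub_const ?_ _).mul_const _
    obtain ⟨r, rfl⟩ := Nat.exists_eq_succ_of_ne_zero hs
    rw [Nat.succ_add]
    exact tendsto_logTower_succ _
  have h := le_of_tendsto (hlim1.sub hlim2).abs
    ((eventually_ge_atTop M).mono fun N hN =>
      bernoulli_expansion_sum (by omega : s + n ≠ 0) hM hN 0 ⟨le_rfl, zero_le_one⟩)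
  have hneg : ∑ k ∈ Finset.range (n + 1), logTower (s + k) M * (bernoulli k / k.factorial)
      = -∑ k ∈ Finset.range (n + 1), (0 - logTower (s + k) M) *
        (bernoulliFun k 0 / k.factorial) := by
    rw [← Finset.sum_neg_distrib]
    refine Finset.sum_congr rfl fun k _ => ?_
    rw [bernoulliFun_eval_zero]
    ring
  rw [hneg, ← sub_eq_add_neg]
  exact h

/-! ### Means of Bernoulli polynomials and of shifted powers. -/

lemma bernoulliFun_bdd (k : ℕ) : ∃ C, BddByOn C (bernoulliFun k) :=
  BddByOn.of_continuousOn (continuous_bernoulliFun k).continuousOn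

lemma bernoulliFun_eq_sum (k : ℕ) (y : ℝ) :
    bernoulliFun k y = ∑ i ∈ Finset.range (k + 1), (bernoulli i * k.choose i : ℝ) * y ^ (k - i) := by
  rw [bernoulliFun, Polynomial.bernoulli]
  simp [Polynomial.map_sum, Polynomial.eval_finsetSum]

lemma pow_eq_sum_bernoulliFun (n : ℕ) (x : ℝ) :
    x ^ n = ∑ k ∈ Finset.range (n + 1), ((n + 1).choose k / (n + 1) : ℝ) * bernoulliFun k x := by
  have h := congrArg (fun p => (p.map (algebraMap ℚ ℝ)).eval x) (Polynomial.sum_bernoulli n)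
  simp only [Polynomial.map_sum, Polynomial.eval_finsetSum, Polynomial.map_smul,
    Polynomial.map_monomial, Polynomial.eval_monomial, Polynomial.eval_smul] at h
  have hn : (n : ℝ) + 1 ≠ 0 := by positivity
  simp only [div_mul_eq_mul_div, ← Finset.sum_div]
  rw [eq_div_iff hn, mul_comm]
  simpa [bernoulliFun] using h.symm

lemma shift_pow_bdd (d j : ℕ) : ∃ C, BddByOn C (fun x => ((d : ℝ) + x) ^ j) :=
  BddByOn.of_continuousOn (by fun_prop)

lemma pow_bdd (j : ℕ) : ∃ C, BddByOn C (fun x => x ^ j) :=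
  BddByOn.of_continuousOn (by fun_prop)

lemma kempnerMean_pow {b d : ℕ} (hd : d < b) (n : ℕ) :
    kempnerMean b d (fun x => x ^ n) = ∑ k ∈ Finset.range (n + 1),
      ((n + 1).choose k / (n + 1) : ℝ) * kempnerMean b d (bernoulliFun k) := by
  simp only [pow_eq_sum_bernoulliFun n]
  exact kempnerMean_lincomb hd _ _ fun k _ => bernoulliFun_bdd k

lemma kempnerMean_shift_pow {b d : ℕ} (hd : d < b) (j : ℕ) :
    kempnerMean b d (fun x => ((d : ℝ) + x) ^ j) = ∑ i ∈ Finset.range (j + 1),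
      ((d : ℝ) ^ i * j.choose i) * kempnerMean b d (fun x => x ^ (j - i)) := by
  rw [← kempnerMean_lincomb hd _ _ fun i _ => pow_bdd (j - i)]
  congr 1
  funext x
  rw [add_pow]
  exact Finset.sum_congr rfl fun i _ => by ring

lemma digitAverage_eq_sub {b d : ℕ} (hd : d < b) (f : ℝ → ℝ) (x : ℝ) :
    digitAverage b d f x = (∑ a ∈ Finset.range b, f ((a + x) / b)) / b - f ((d + x) / b) / b := by
  rw [digitAverage, ← Finset.add_sum_erase _ _ (Finset.mem_range.2 hd)]
  ring

/-- This is the invariance for B_k. The sum over all digits is evaluated by the multiplication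
theorem, and the deleted term B_k((d + x)/b)/b is expanded in powers of (d + x)/b. -/
lemma kempnerMean_bernoulliFun {b d : ℕ} (hd : d < b) (k : ℕ) :
    kempnerMean b d (bernoulliFun k)
      = (1 / (b : ℝ)) ^ k * kempnerMean b d (bernoulliFun k)
        - 1 / (b : ℝ) * ∑ i ∈ Finset.range k, (bernoulli i * k.choose i : ℝ) *
          ((1 / (b : ℝ)) ^ (k - i) * kempnerMean b d (fun x => ((d : ℝ) + x) ^ (k - i))) := by
  have hb0 : b ≠ 0 := by omega
  have hb : (b : ℝ) ≠ 0 := by exact_mod_cast hb0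
  obtain ⟨C, hC⟩ := bernoulliFun_bdd k
  have hQ : digitAverage b d (bernoulliFun k) = fun x => (1 / (b : ℝ)) ^ k * bernoulliFun k x
      + (-(1 / (b : ℝ))) * ∑ i ∈ Finset.range (k + 1), (bernoulli i * k.choose i *
        (1 / (b : ℝ)) ^ (k - i)) * ((d : ℝ) + x) ^ (k - i) := by
    funext x
    have h1 : ∑ a ∈ Finset.range b, bernoulliFun k ((a + x) / b)
        = b * ((1 / (b : ℝ)) ^ k * bernoulliFun k x) := by
      have h := bernoulliFun_mul k hb0 (x / b)
      rw [mul_div_cancel₀ _ hb] at h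
      rw [h]
      have h2 : ∀ a : ℕ, x / b + a / b = (a + x) / b := fun a => by ring
      simp only [h2]
      rw [one_div, inv_pow]
      field_simp
    rw [digitAverage_eq_sub hd, h1, mul_div_cancel_left₀ _ hb, bernoulliFun_eq_sum k ((d + x) / b)]
    simp only [div_pow, one_pow]
    rw [neg_mul, ← sub_eq_add_neg]
    congr 1
    rw [div_eq_inv_mul, one_div]
    refine congrArg _ (Finset.sum_congr rfl fun i _ => ?_)
    ring
  have h := hC.mul_kempnerMean hd
  have hbd : ∀ i ∈ Finset.range (k + 1), ∃ C, BddByOn C (fun x => ((d : ℝ) + x) ^ (k - i)) :=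
    fun i _ => shift_pow_bdd d (k - i)
  have hS : ∃ C, BddByOn C (fun x => ∑ i ∈ Finset.range (k + 1), (bernoulli i * k.choose i *
        (1 / (b : ℝ)) ^ (k - i)) * ((d : ℝ) + x) ^ (k - i)) :=
    BddByOn.of_continuousOn (by fun_prop)
  have hB : ∃ C, BddByOn C (fun x => (1 / (b : ℝ)) ^ k * bernoulliFun k x) :=
    BddByOn.of_continuousOn ((continuous_bernoulliFun k).const_mul _).continuousOn
  have hS' : ∃ C, BddByOn C (fun x => (-(1 / (b : ℝ))) * ∑ i ∈ Finset.range (k + 1),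
      (bernoulli i * k.choose i * (1 / (b : ℝ)) ^ (k - i)) * ((d : ℝ) + x) ^ (k - i)) :=
    BddByOn.of_continuousOn (by fun_prop)
  obtain ⟨C1, hC1⟩ := hS
  obtain ⟨C2, hC2⟩ := hB
  obtain ⟨C3, hC3⟩ := hS'
  rw [hQ, kempnerMean_add hd hC2 hC3, kempnerMean_const_mul hd _ hC,
    kempnerMean_const_mul hd _ hC1, kempnerMean_lincomb hd _ _ hbd, Finset.sum_range_succ,
    bernoulliFun_eval_zero] at h
  -- The top index i = k contributes the constant `bernoulli k`, which cancels f(0) = B_k(0); hence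
  -- the sum runs over i < k only.
  simp only [Nat.sub_self, pow_zero, kempnerMean_one hd, Nat.choose_self] at h
  have h' : ∑ i ∈ Finset.range k, (bernoulli i * k.choose i : ℝ) *
      ((1 / (b : ℝ)) ^ (k - i) * kempnerMean b d (fun x => ((d : ℝ) + x) ^ (k - i)))
      = ∑ i ∈ Finset.range k, (bernoulli i * k.choose i : ℝ) *
      (1 / (b : ℝ)) ^ (k - i) * kempnerMean b d (fun x => ((d : ℝ) + x) ^ (k - i)) :=
    Finset.sum_congr rfl fun i _ => by ring
  rw [← h'] at h
  set S := ∑ i ∈ Finset.range k, (bernoulli i * k.choose i : ℝ) *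
      ((1 / (b : ℝ)) ^ (k - i) * kempnerMean b d (fun x => ((d : ℝ) + x) ^ (k - i)))
  refine mul_left_cancel₀ hb (h.trans ?_)
  push_cast
  field_simp
  ring

/-! The main formula. -/

lemma sum_Ico_digit_blocks (b N : ℕ) (hN : 1 ≤ N) (g : ℕ → ℝ) :
    ∑ a ∈ Finset.Ico 1 N, ∑ c ∈ Finset.range b, g (a * b + c) = ∑ n ∈ Finset.Ico b (N * b), g n := by
  induction N, hN using Nat.le_induction with
  | base => simp
  | succ N hN ih =>
    rw [Finset.sum_Ico_succ_top hN, ih,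
      ← Finset.sum_Ico_consecutive _ (Nat.le_mul_of_pos_left b hN)
        (Nat.mul_le_mul_right b (Nat.le_succ N)), Finset.sum_Ico_eq_sum_range _ (N * b)]
    congr 2
    rw [Nat.add_one_mul, Nat.add_sub_cancel_left]

/-- Here n = ab + c runs over two-digit numbers. The subtracted block restores a ≠ d, and the last
term restores c ≠ d. -/
lemma digitAverage_digitKernel {b d : ℕ} (hd : 0 < d) (hdb : d < b) {x : ℝ} :
    digitAverage b d (digitKernel b d) x
      = ((∑ n ∈ Finset.Ico b (b * b), 1 / ((n : ℝ) + x))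
        - ∑ n ∈ Finset.Ico (d * b) (d * b + b), 1 / ((n : ℝ) + x))
        - digitKernel b d ((d + x) / b) / b := by
  have hb : (b : ℝ) ≠ 0 := by exact_mod_cast (by omega : b ≠ 0)
  rw [digitAverage_eq_sub hdb]
  congr 1
  have h1 : ∀ a : ℕ, ∑ n ∈ Finset.Ico (a * b) (a * b + b), 1 / ((n : ℝ) + x)
      = ∑ c ∈ Finset.range b, 1 / (((a * b + c : ℕ) : ℝ) + x) := fun a => by
    rw [Finset.sum_Ico_eq_sum_range, Nat.add_sub_cancel_left]
  rw [h1, ← sum_Ico_digit_blocks b b (by omega) (fun n => 1 / ((n : ℝ) + x)),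
    ← Finset.sum_erase_eq_sub (Finset.mem_Ico.2 ⟨hd, hdb⟩)]
  simp only [digitKernel]
  rw [Finset.sum_comm, Finset.sum_div]
  refine Finset.sum_congr rfl fun a _ => ?_
  rw [Finset.sum_div]
  refine Finset.sum_congr rfl fun c _ => ?_
  rw [div_div, add_mul, div_mul_cancel₀ _ hb]
  push_cast
  rw [add_assoc]

/-- The sum of `a ^ (-s)` over the nonzero digits `a ≠ d`. -/
noncomputable def digitZeta (b d s : ℕ) : ℝ :=
  ∑ a ∈ (Finset.Ico 1 b).erase d, 1 / (a : ℝ) ^ s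

/-- The remainder is exactly (-y)^n / (a^n (a + y)), so a ≥ 1 suffices and y need not be small. -/
lemma abs_one_div_add_sub_geom_le {a y : ℝ} (ha : 1 ≤ a) (hy : 0 ≤ y) (n : ℕ) :
    |1 / (a + y) - ∑ j ∈ Finset.range n, (-y) ^ j * (1 / a ^ (j + 1))| ≤ y ^ n := by
  have ha0 : a ≠ 0 := by linarith
  have hay : a + y ≠ 0 := by linarith
  have key : 1 / (a + y) - ∑ j ∈ Finset.range n, (-y) ^ j * (1 / a ^ (j + 1))
      = (-y) ^ n * (1 / (a ^ n * (a + y))) := by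
    induction n with
    | zero => simp
    | succ n ih =>
      rw [Finset.sum_range_succ, ← sub_sub, ih]
      field_simp
      ring
  rw [key, abs_mul, abs_pow, abs_neg, abs_of_nonneg hy, abs_of_nonneg (by positivity)]
  refine mul_le_of_le_one_right (by positivity) ?_
  rw [div_le_one (by positivity)]
  exact one_le_mul_of_one_le_of_one_le (one_le_pow₀ ha) (by linarith)

lemma abs_digitKernel_sub_le (b d n : ℕ) {y : ℝ} (hy : 0 ≤ y) :
    |digitKernel b d y - ∑ j ∈ Finset.range n, (-y) ^ j * digitZeta b d (j + 1)| ≤ b * y ^ n := by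
  simp only [digitKernel, digitZeta, Finset.mul_sum]
  rw [Finset.sum_comm, ← Finset.sum_sub_distrib]
  refine (Finset.abs_sum_le_sum_abs _ _).trans ?_
  calc _ ≤ ∑ a ∈ (Finset.Ico 1 b).erase d, y ^ n := Finset.sum_le_sum fun a ha =>
        abs_one_div_add_sub_geom_le
          (by exact_mod_cast (Finset.mem_Ico.1 (Finset.mem_of_mem_erase ha)).1) hy n
    _ ≤ b * y ^ n := by
      rw [Finset.sum_const, nsmul_eq_mul]
      gcongr
      exact_mod_cast (Finset.card_le_card (Finset.erase_subset _ _)).trans (by simp)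

lemma kempnerMean_digitKernel_arg {b d : ℕ} (hdb : d < b) (n : ℕ) :
    |kempnerMean b d (fun x => digitKernel b d ((d + x) / b))
      - ∑ j ∈ Finset.range n, ((-(1 / (b : ℝ))) ^ j * digitZeta b d (j + 1)) *
          kempnerMean b d (fun x => ((d : ℝ) + x) ^ j)| ≤ b * ((d + 1) / b) ^ n := by
  have hb : (0 : ℝ) < b := by exact_mod_cast (by omega : 0 < b)
  have hS : ∃ C, BddByOn C (fun x => ∑ j ∈ Finset.range n,
      ((-(1 / (b : ℝ))) ^ j * digitZeta b d (j + 1)) * ((d : ℝ) + x) ^ j) :=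
    BddByOn.of_continuousOn (by fun_prop)
  obtain ⟨C, hC⟩ := hS
  have hR : BddByOn (b * ((d + 1) / b) ^ n) (fun x => digitKernel b d ((d + x) / b) -
      ∑ j ∈ Finset.range n,
      ((-(1 / (b : ℝ))) ^ j * digitZeta b d (j + 1)) * ((d : ℝ) + x) ^ j) := by
    intro x hx
    have hy : 0 ≤ ((d : ℝ) + x) / b := div_nonneg (add_nonneg (Nat.cast_nonneg d) hx.1) hb.le
    refine le_trans (le_of_eq ?_) ((abs_digitKernel_sub_le b d n hy).trans ?_)
    · refine congrArg _ (congrArg _ (Finset.sum_congr rfl fun j _ => ?_))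
      rw [neg_pow, neg_pow ((d + x) / (b : ℝ)), div_pow, div_pow]
      ring
    · gcongr
      exact hx.2
  have h := kempnerMean_add hdb hR hC
  simp only [sub_add_cancel] at h
  rw [h, kempnerMean_lincomb hdb _ _ fun j _ => shift_pow_bdd d j, add_sub_cancel_right]
  exact hR.abs_kempnerMean_le hdb

/-- The differences of the derivatives of the logarithm in the two-digit formula. -/
noncomputable def twoDigitCoeff (b d k : ℕ) : ℝ :=
  (logTower k ((b * b : ℕ) : ℝ) - logTower k b)
    - (logTower k ((d * b + b : ℕ) : ℝ) - logTower k ((d * b : ℕ) : ℝ))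

/-- Euler-Maclaurin is applied on both ranges; as d ≥ 1, both start at or beyond b and each error is
at most 4 (n + 1)!/b^(n+1). -/
lemma twoDigitSum_bdd {b d : ℕ} (hd : 0 < d) (hdb : d < b) (n : ℕ) :
    BddByOn (8 * (n + 1).factorial / (b : ℝ) ^ (n + 1)) fun x =>
      ((∑ n ∈ Finset.Ico b (b * b), 1 / ((n : ℝ) + x))
        - ∑ n ∈ Finset.Ico (d * b) (d * b + b), 1 / ((n : ℝ) + x))
      - ∑ k ∈ Finset.range (n + 2), (twoDigitCoeff b d k / k.factorial) * bernoulliFun k x := by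
  intro x hx
  have hb0 : 0 < b := by omega
  have hb : (0 : ℝ) < b := by exact_mod_cast hb0
  have hd1 : (1 : ℝ) ≤ d := by exact_mod_cast hd
  have h1 := bernoulli_expansion_sum (s := 0) (n := n + 1) (by omega) hb0
    (Nat.le_mul_of_pos_left b hb0) x hx
  have h2 := bernoulli_expansion_sum (s := 0) (n := n + 1) (by omega) (Nat.mul_pos hd hb0)
    (Nat.le_add_right (d * b) b) x hx
  have h3 : 4 * ((0 + (n + 1)).factorial : ℝ) / ((d * b : ℕ) : ℝ) ^ (0 + (n + 1))
      ≤ 4 * ((0 + (n + 1)).factorial : ℝ) / (b : ℝ) ^ (0 + (n + 1)) := by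
    gcongr
    exact Nat.le_mul_of_pos_left b hd
  have h4 := (abs_sub _ _).trans (add_le_add h1 (h2.trans h3))
  refine le_trans (le_of_eq ?_) (h4.trans (le_of_eq ?_))
  · congr 1
    simp only [twoDigitCoeff, zero_add, logTower, pow_zero, Nat.factorial_zero, Nat.cast_one,
      one_mul, pow_one]
    rw [sub_sub_sub_comm, ← Finset.sum_sub_distrib]
    refine congrArg _ (Finset.sum_congr rfl fun k _ => ?_)
    ring
  · rw [zero_add]
    ring

lemma twoDigitCoeff_zero {b d : ℕ} (hd : 0 < d) (hdb : d < b) :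
    twoDigitCoeff b d 0 = Real.log b - Real.log (1 + 1 / (d : ℝ)) := by
  have hb : (b : ℝ) ≠ 0 := by exact_mod_cast (by omega : b ≠ 0)
  have hd' : (d : ℝ) ≠ 0 := by exact_mod_cast hd.ne'
  have hd1 : (d : ℝ) + 1 ≠ 0 := by positivity
  have e1 : ((d : ℝ) * b + b) = (d + 1) * b := by ring
  have e2 : 1 + 1 / (d : ℝ) = (d + 1) / d := by field_simp
  simp only [twoDigitCoeff, logTower]
  push_cast
  rw [e1, e2, Real.log_mul hb hb, Real.log_mul hd1 hb, Real.log_mul hd' hb, Real.log_div hd1 hd']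
  ring

lemma kempnerSum_formula {b d : ℕ} (hd : 0 < d) (hdb : d < b) (n : ℕ) :
    |kempnerSum b d - (b * Real.log b - b * Real.log (1 + 1 / (d : ℝ)))
      - (b * ∑ k ∈ Finset.range (n + 1), twoDigitCoeff b d (k + 1) / (k + 1).factorial *
            kempnerMean b d (bernoulliFun (k + 1))
        - ∑ j ∈ Finset.range n, ((-(1 / (b : ℝ))) ^ (j + 1) * digitZeta b d (j + 2)) *
            kempnerMean b d (fun x => ((d : ℝ) + x) ^ (j + 1)))|
      ≤ (8 * (n + 1).factorial + (d + 1) ^ (n + 1)) * (1 / (b : ℝ)) ^ n := by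
  have hb : (0 : ℝ) < b := by exact_mod_cast (by omega : 0 < b)
  have hb' := hb.ne'
  have hA := twoDigitSum_bdd hd hdb n
  obtain ⟨C, hS⟩ : ∃ C, BddByOn C (fun x => ∑ k ∈ Finset.range (n + 2),
      (twoDigitCoeff b d k / k.factorial) * bernoulliFun k x) :=
    BddByOn.of_continuousOn (continuous_finsetSum _ fun k _ =>
      (continuous_bernoulliFun k).const_mul _).continuousOn
  obtain ⟨C', hD⟩ : ∃ C, BddByOn C (fun x => digitKernel b d ((d + x) / b)) :=
    ⟨b, fun x hx => digitKernel_bdd b d _ (digit_point_mem hdb hx)⟩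
  have hD' : BddByOn (|-(1 / (b : ℝ))| * C')
      (fun x => -(1 / (b : ℝ)) * digitKernel b d ((d + x) / b)) := fun x hx => by
    rw [abs_mul]
    exact mul_le_mul_of_nonneg_left (hD x hx) (abs_nonneg _)
  have h := (digitKernel_bdd b d).mul_kempnerMean hdb
  have hQ : digitAverage b d (digitKernel b d) = fun x =>
      (((∑ n ∈ Finset.Ico b (b * b), 1 / ((n : ℝ) + x))
        - ∑ n ∈ Finset.Ico (d * b) (d * b + b), 1 / ((n : ℝ) + x))
      - ∑ k ∈ Finset.range (n + 2), (twoDigitCoeff b d k / k.factorial) * bernoulliFun k x)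
      + (∑ k ∈ Finset.range (n + 2), (twoDigitCoeff b d k / k.factorial) * bernoulliFun k x
      + -(1 / (b : ℝ)) * digitKernel b d ((d + x) / b)) := by
    funext x
    rw [digitAverage_digitKernel hd hdb]
    ring
  obtain ⟨C'', hSD⟩ : ∃ C, BddByOn C (fun x => ∑ k ∈ Finset.range (n + 2),
      (twoDigitCoeff b d k / k.factorial) * bernoulliFun k x
      + -(1 / (b : ℝ)) * digitKernel b d ((d + x) / b)) :=
    ⟨_, fun x hx => (abs_add_le _ _).trans (add_le_add (hS x hx) (hD' x hx))⟩
  rw [← kempnerSum_eq hd hdb, hQ, kempnerMean_add hdb hA hSD, kempnerMean_add hdb hS hD',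
    kempnerMean_const_mul hdb _ hD, kempnerMean_lincomb hdb _ _ fun k _ => bernoulliFun_bdd k] at h
  -- Both errors are taken at order n + 1: one power of b is lost to the factor b in front of the
  -- first mean, and one to the crude factor b in the second bound.
  have hE := hA.abs_kempnerMean_le hdb
  have hF := kempnerMean_digitKernel_arg hdb (n + 1)
  set A := kempnerMean b d fun x =>
      ((∑ n ∈ Finset.Ico b (b * b), 1 / ((n : ℝ) + x))
        - ∑ n ∈ Finset.Ico (d * b) (d * b + b), 1 / ((n : ℝ) + x))
      - ∑ k ∈ Finset.range (n + 2), (twoDigitCoeff b d k / k.factorial) * bernoulliFun k x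
  set D := kempnerMean b d (fun x => digitKernel b d ((d + x) / b))
  have hB0 : bernoulliFun 0 = fun _ => 1 := funext bernoulliFun_zero
  have hH0 : digitKernel b d 0 = digitZeta b d 1 := by simp [digitKernel, digitZeta]
  rw [Finset.sum_range_succ' _ (n + 1), hB0, kempnerMean_one hdb, twoDigitCoeff_zero hd hdb,
    hH0] at h
  rw [Finset.sum_range_succ' _ n] at hF
  simp only [pow_zero, kempnerMean_one hdb, Nat.factorial_zero, Nat.cast_one, div_one, mul_one,
    one_mul, zero_add] at h hF
  set S := ∑ k ∈ Finset.range (n + 1), twoDigitCoeff b d (k + 1) / (k + 1).factorial *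
            kempnerMean b d (bernoulliFun (k + 1))
  set T := ∑ j ∈ Finset.range n, ((-(1 / (b : ℝ))) ^ (j + 1) * digitZeta b d (j + 1 + 1)) *
            kempnerMean b d (fun x => ((d : ℝ) + x) ^ (j + 1))
  -- The value H(0) equals `digitZeta b d 1`, the j = 0 term of the geometric expansion, and the two
  -- cancel.
  have key : kempnerSum b d - (b * Real.log b - b * Real.log (1 + 1 / (d : ℝ))) - (b * S - T)
      = b * A - (D - (T + digitZeta b d 1)) := by
    rw [h]
    field_simp
    ring
  have hbE : |b * A| ≤ 8 * (n + 1).factorial * (1 / (b : ℝ)) ^ n := by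
    rw [abs_mul, abs_of_pos hb]
    refine (mul_le_mul_of_nonneg_left hE hb.le).trans (le_of_eq ?_)
    rw [one_div, inv_pow, pow_succ]
    field_simp
  have hbF : b * (((d : ℝ) + 1) / b) ^ (n + 1) = (d + 1) ^ (n + 1) * (1 / (b : ℝ)) ^ n := by
    rw [div_pow, one_div, inv_pow, pow_succ (b : ℝ)]
    field_simp
  calc _ = |b * A - (D - (T + digitZeta b d 1))| := congrArg _ key
    _ ≤ _ := (abs_sub _ _).trans (add_le_add hbE (hF.trans_eq hbF))
    _ = _ := by ring

/-! Asymptotic expansions in powers of `1 / b`. -/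

/-- `f b` and `g b` agree up to terms of order `b ^ (-N)`. -/
def EqMod (N : ℕ) (f g : ℕ → ℝ) : Prop :=
  (fun b : ℕ => f b - g b) =O[atTop] fun b : ℕ => (1 / (b : ℝ)) ^ N

lemma inv_pow_isBigO {M N : ℕ} (h : M ≤ N) :
    (fun b : ℕ => (1 / (b : ℝ)) ^ N) =O[atTop] fun b : ℕ => (1 / (b : ℝ)) ^ M := by
  refine IsBigO.of_bound 1 ((eventually_ge_atTop 1).mono fun b hb => ?_)
  have hb' : (1 : ℝ) ≤ b := by exact_mod_cast hb
  rw [one_mul, Real.norm_of_nonneg (by positivity), Real.norm_of_nonneg (by positivity)]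
  exact pow_le_pow_of_le_one (by positivity) ((div_le_one (by linarith)).2 hb') h

lemma EqMod.of_abs_le {N : ℕ} {f g : ℕ → ℝ} (C : ℝ)
    (h : ∀ᶠ b : ℕ in atTop, |f b - g b| ≤ C * (1 / (b : ℝ)) ^ N) : EqMod N f g :=
  IsBigO.of_bound C (h.mono fun b hb => by
    rwa [Real.norm_eq_abs, Real.norm_of_nonneg (by positivity : 0 ≤ (1 / (b : ℝ)) ^ N)])

lemma EqMod.of_eventuallyEq {f g : ℕ → ℝ} (N : ℕ) (h : ∀ᶠ b in atTop, f b = g b) :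
    EqMod N f g :=
  .of_abs_le 0 (h.mono fun b hb => by simp [hb])

lemma EqMod.refl (N : ℕ) (f : ℕ → ℝ) : EqMod N f f := .of_eventuallyEq N (.of_forall fun _ => rfl)

lemma EqMod.symm {N : ℕ} {f g : ℕ → ℝ} (h : EqMod N f g) : EqMod N g f :=
  (IsBigO.neg_left h).congr_left fun b => by ring

lemma EqMod.trans {N : ℕ} {f g k : ℕ → ℝ} (h : EqMod N f g) (h' : EqMod N g k) : EqMod N f k :=
  (IsBigO.add h h').congr_left fun b => by ring

lemma EqMod.mono {M N : ℕ} {f g : ℕ → ℝ} (h : EqMod N f g) (hMN : M ≤ N) : EqMod M f g :=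
  IsBigO.trans h (inv_pow_isBigO hMN)

lemma EqMod.add {N : ℕ} {f g f' g' : ℕ → ℝ} (h : EqMod N f g) (h' : EqMod N f' g') :
    EqMod N (fun b => f b + f' b) (fun b => g b + g' b) :=
  (IsBigO.add h h').congr_left fun b => by ring

lemma EqMod.const_mul {N : ℕ} {f g : ℕ → ℝ} (c : ℝ) (h : EqMod N f g) :
    EqMod N (fun b => c * f b) (fun b => c * g b) :=
  (IsBigO.const_mul_left h c).congr_left fun b => by ring

lemma EqMod.sum {ι : Type*} {N : ℕ} {s : Finset ι} {f g : ι → ℕ → ℝ}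
    (h : ∀ i ∈ s, EqMod N (f i) (g i)) :
    EqMod N (fun b => ∑ i ∈ s, f i b) (fun b => ∑ i ∈ s, g i b) :=
  (IsBigO.sum h).congr_left fun b => by simp [Finset.sum_sub_distrib]

lemma EqMod.mul_of_zero {M N : ℕ} {f g k : ℕ → ℝ} (h : EqMod N f g)
    (hk : EqMod M k fun _ => 0) :
    EqMod (N + M) (fun b => f b * k b) (fun b => g b * k b) :=
  (IsBigO.mul h hk).congr (fun b => by ring) fun b => by ring

lemma EqMod.inv_pow_zero (k : ℕ) : EqMod k (fun b : ℕ => (1 / (b : ℝ)) ^ k) fun _ => 0 :=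
  .of_abs_le 1 (.of_forall fun b => by
    rw [sub_zero, one_mul, abs_of_nonneg (by positivity)])

lemma EqMod.inv_pow_mul {N : ℕ} {f g : ℕ → ℝ} (k : ℕ) (h : EqMod N f g) :
    EqMod (N + k) (fun b => (1 / (b : ℝ)) ^ k * f b) (fun b => (1 / (b : ℝ)) ^ k * g b) := by
  simpa only [mul_comm] using h.mul_of_zero (.inv_pow_zero k)

/-- Split ff' - gg' as f(f' - g') + (f - g)g'; only f and g' have to be bounded. -/
lemma EqMod.mul {N : ℕ} {f g f' g' : ℕ → ℝ} (h : EqMod N f g) (h' : EqMod N f' g')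
    (hf : EqMod 0 f fun _ => 0) (hg : EqMod 0 g' fun _ => 0) :
    EqMod N (fun b => f b * f' b) (fun b => g b * g' b) := by
  have h1 := h'.mul_of_zero hf
  have h2 := h.mul_of_zero hg
  simp only [mul_comm _ (f _)] at h1
  exact h1.trans h2

lemma tendsto_eval_inv (q : Polynomial ℝ) :
    Tendsto (fun b : ℕ => q.eval (1 / (b : ℝ))) atTop (nhds (q.coeff 0)) := by
  have h := (q.continuous.tendsto 0).comp (tendsto_one_div_atTop_nhds_zero_nat (𝕜 := ℝ))
  rwa [← Polynomial.coeff_zero_eq_eval_zero] at h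

lemma EqMod.eval_inv_zero (q : Polynomial ℝ) :
    EqMod 0 (fun b : ℕ => q.eval (1 / (b : ℝ))) fun _ => 0 := by
  have := (tendsto_eval_inv q).isBigO_one ℝ
  simpa [EqMod] using this

/-- Letting b → ∞ kills the constant coefficient; dividing by 1/b lowers the order by one. -/
lemma coeff_eq_zero_of_eqMod {N : ℕ} {q : Polynomial ℝ}
    (h : EqMod N (fun b : ℕ => q.eval (1 / (b : ℝ))) fun _ => 0) : ∀ i < N, q.coeff i = 0 := by
  induction N generalizing q with
  | zero => intro i hi; omega
  | succ N ih =>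
    have hX : Tendsto (fun b : ℕ => (1 / (b : ℝ)) ^ (N + 1)) atTop (nhds 0) := by
      simpa using (tendsto_one_div_atTop_nhds_zero_nat (𝕜 := ℝ)).pow (N + 1)
    have h0 : q.coeff 0 = 0 := by
      have h1 := IsBigO.trans_tendsto h hX
      simp only [sub_zero] at h1
      exact tendsto_nhds_unique (tendsto_eval_inv q) h1
    have hdiv : EqMod N (fun b : ℕ => q.divX.eval (1 / (b : ℝ))) fun _ => 0 := by
      obtain ⟨C, hC⟩ := IsBigO.bound h
      refine .of_abs_le C ?_
      filter_upwards [hC, eventually_gt_atTop 0] with b hb hb0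
      have hb' : (0 : ℝ) < 1 / (b : ℝ) := by positivity
      have hq : q.eval (1 / (b : ℝ)) = q.divX.eval (1 / (b : ℝ)) * (1 / (b : ℝ)) := by
        conv_lhs => rw [← q.divX_mul_X_add, h0]
        simp
      rw [sub_zero, hq, norm_mul, pow_succ, norm_mul, Real.norm_of_nonneg hb'.le, ← mul_assoc,
        Real.norm_of_nonneg (by positivity : 0 ≤ (1 / (b : ℝ)) ^ N)] at hb
      rw [sub_zero]
      exact le_of_mul_le_mul_right hb hb'
    rintro (_ | i) hi
    · exact h0
    · rw [← Polynomial.coeff_divX]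
      exact ih hdiv i (by omega)

lemma coeff_eq_of_eqMod {N : ℕ} {p q : Polynomial ℝ}
    (h : EqMod N (fun b : ℕ => p.eval (1 / (b : ℝ))) fun b : ℕ => q.eval (1 / (b : ℝ))) :
    ∀ i < N, p.coeff i = q.coeff i := by
  intro i hi
  have h' : EqMod N (fun b : ℕ => (p - q).eval (1 / (b : ℝ))) fun _ => 0 := by
    simpa [EqMod] using h
  have := coeff_eq_zero_of_eqMod h' i hi
  rwa [Polynomial.coeff_sub, sub_eq_zero] at this

lemma eval_eqMod_trunc (N : ℕ) (q : Polynomial ℝ) :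
    EqMod N (fun b : ℕ => q.eval (1 / (b : ℝ)))
      fun b : ℕ => ∑ i ∈ Finset.range N, q.coeff i * (1 / (b : ℝ)) ^ i := by
  have h : ∀ b : ℕ, q.eval (1 / (b : ℝ))
      = ∑ i ∈ Finset.range (N + (q.natDegree + 1)), q.coeff i * (1 / (b : ℝ)) ^ i := fun b =>
    Polynomial.eval_eq_sum_range' (by omega) _
  simp only [h, Finset.sum_range_add _ N]
  have hz : ∀ i ∈ Finset.range (q.natDegree + 1),
      EqMod N (fun b : ℕ => q.coeff (N + i) * (1 / (b : ℝ)) ^ (N + i)) fun _ => q.coeff (N + i) * 0 :=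
    fun i _ => ((EqMod.inv_pow_zero (N + i)).const_mul _).mono (Nat.le_add_right N i)
  simpa using (EqMod.refl N fun b : ℕ =>
    ∑ i ∈ Finset.range N, q.coeff i * (1 / (b : ℝ)) ^ i).add (EqMod.sum hz)

/-- `f b` is a polynomial in `1 / b` up to terms of order `b ^ (-N)`. -/
def Expands (N : ℕ) (f : ℕ → ℝ) : Prop :=
  ∃ q : Polynomial ℝ, EqMod N f fun b : ℕ => q.eval (1 / (b : ℝ))

lemma Expands.of_eqMod {N : ℕ} {f g : ℕ → ℝ} (hg : Expands N g) (h : EqMod N f g) :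
    Expands N f :=
  hg.imp fun _ hq => h.trans hq

lemma Expands.const (N : ℕ) (c : ℝ) : Expands N fun _ => c :=
  ⟨.C c, by simpa using EqMod.refl N _⟩

lemma Expands.mono {M N : ℕ} {f : ℕ → ℝ} (h : Expands N f) (hMN : M ≤ N) : Expands M f :=
  h.imp fun _ hq => hq.mono hMN

lemma Expands.add {N : ℕ} {f g : ℕ → ℝ} (hf : Expands N f) (hg : Expands N g) :
    Expands N fun b => f b + g b := by
  obtain ⟨p, hp⟩ := hf
  obtain ⟨q, hq⟩ := hg
  exact ⟨p + q, by simpa using hp.add hq⟩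

lemma Expands.const_mul {N : ℕ} {f : ℕ → ℝ} (c : ℝ) (hf : Expands N f) :
    Expands N fun b => c * f b := by
  obtain ⟨p, hp⟩ := hf
  exact ⟨.C c * p, by simpa using hp.const_mul c⟩

lemma Expands.sub {N : ℕ} {f g : ℕ → ℝ} (hf : Expands N f) (hg : Expands N g) :
    Expands N fun b => f b - g b := by
  simpa [sub_eq_add_neg] using hf.add (hg.const_mul (-1))

lemma Expands.sum {ι : Type*} {N : ℕ} {s : Finset ι} {f : ι → ℕ → ℝ}
    (h : ∀ i ∈ s, Expands N (f i)) : Expands N fun b => ∑ i ∈ s, f i b := by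
  classical
  induction s using Finset.induction_on with
  | empty => simpa using Expands.const N 0
  | insert i s hi ih =>
    simp only [Finset.sum_insert hi]
    exact (h i (by simp)).add (ih fun j hj => h j (by simp [hj]))

lemma Expands.inv_pow_mul {N : ℕ} {f : ℕ → ℝ} (k : ℕ) (hf : Expands N f) :
    Expands (N + k) fun b => (1 / (b : ℝ)) ^ k * f b := by
  obtain ⟨p, hp⟩ := hf
  exact ⟨.X ^ k * p, by simpa using hp.inv_pow_mul k⟩

lemma Expands.bounded {N : ℕ} {f : ℕ → ℝ} (hf : Expands N f) : EqMod 0 f fun _ => 0 := by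
  obtain ⟨p, hp⟩ := hf
  exact (hp.mono (Nat.zero_le N)).trans (.eval_inv_zero p)

lemma Expands.mul {N : ℕ} {f g : ℕ → ℝ} (hf : Expands N f) (hg : Expands N g) :
    Expands N fun b => f b * g b := by
  have hfb := hf.bounded
  obtain ⟨p, hp⟩ := hf
  obtain ⟨q, hq⟩ := hg
  exact ⟨p * q, by simpa using hp.mul hq hfb (.eval_inv_zero q)⟩

lemma hasInversePowerExpansion_of_eqMod {f : ℕ → ℝ} {a : ℕ → ℝ} (h0 : a 0 = 0)
    (h : ∀ N, EqMod N f fun b : ℕ => ∑ i ∈ Finset.range N, a i * (1 / (b : ℝ)) ^ i) :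
    HasInversePowerExpansion f a := by
  intro N
  have h1 := h (N + 1)
  refine IsBigO.congr h1 (fun b => ?_) fun b => by rw [one_div_pow]
  dsimp only
  rw [Finset.sum_range_succ', h0, zero_mul, add_zero, Finset.range_eq_Ico,
    Finset.sum_Ico_add' (fun i => a i * (1 / (b : ℝ)) ^ i)]
  refine congrArg _ (Finset.sum_congr (by ext; simp) fun i _ => ?_)
  rw [one_div_pow, mul_one_div]

/-! Expansions of the means of the Bernoulli polynomials. -/

lemma eqMod_zero_kempnerMean (d : ℕ) {f : ℝ → ℝ} (hf : ∃ C, BddByOn C f) :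
    EqMod 0 (fun b => kempnerMean b d f) fun _ => 0 := by
  obtain ⟨C, hC⟩ := hf
  refine .of_abs_le C ((eventually_gt_atTop d).mono fun b hb => ?_)
  simpa using hC.abs_kempnerMean_le hb

lemma expands_shift_pow {d N : ℕ}
    (h : ∀ k, Expands N fun b => kempnerMean b d (bernoulliFun k)) (j : ℕ) :
    Expands N fun b => kempnerMean b d fun x => ((d : ℝ) + x) ^ j := by
  have hv : ∀ n, Expands N fun b => kempnerMean b d fun x => x ^ n := fun n =>
    (Expands.sum fun k _ => (h k).const_mul _).of_eqMod
      (.of_eventuallyEq N ((eventually_gt_atTop d).mono fun b hb => kempnerMean_pow hb n))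
  exact (Expands.sum fun i _ => (hv (j - i)).const_mul _).of_eqMod
    (.of_eventuallyEq N ((eventually_gt_atTop d).mono fun b hb => kempnerMean_shift_pow hb j))

/-- The induction on the order N treats all k at once, since the recursion for one k calls on
moments of all degrees up to k. Its right side gains at least one power of 1/b. -/
lemma expands_bernoulliFun (d N : ℕ) :
    ∀ k, Expands N fun b => kempnerMean b d (bernoulliFun k) := by
  induction N with
  | zero =>
    exact fun k => ⟨0, by simpa using eqMod_zero_kempnerMean d (bernoulliFun_bdd k)⟩
  | succ N ih =>
    rintro (_ | k)
    · refine (Expands.const (N + 1) 1).of_eqMod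
        (.of_eventuallyEq _ ((eventually_gt_atTop d).mono fun b hb => ?_))
      have hB0 : bernoulliFun 0 = fun _ => 1 := funext bernoulliFun_zero
      rw [hB0, kempnerMean_one hb]
    · have h1 : Expands (N + 1) fun b : ℕ =>
          (1 / (b : ℝ)) ^ (k + 1) * kempnerMean b d (bernoulliFun (k + 1)) :=
        ((ih (k + 1)).inv_pow_mul (k + 1)).mono (by omega)
      have h2 : Expands (N + 1) fun b : ℕ => (1 / (b : ℝ)) ^ 1 *
          ∑ i ∈ Finset.range (k + 1), (bernoulli i * (k + 1).choose i : ℝ) *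
          ((1 / (b : ℝ)) ^ (k + 1 - i) *
            kempnerMean b d (fun x => ((d : ℝ) + x) ^ (k + 1 - i))) :=
        (Expands.sum fun i _ => (((expands_shift_pow ih (k + 1 - i)).inv_pow_mul
          (k + 1 - i)).mono (by omega)).const_mul _).inv_pow_mul 1
      refine (h1.sub h2).of_eqMod
        (.of_eventuallyEq _ ((eventually_gt_atTop d).mono fun b hb => ?_))
      rw [pow_one]
      exact kempnerMean_bernoulliFun hb (k + 1)

lemma logTower_succ_natCast (k b : ℕ) :
    logTower (k + 1) b = (-1) ^ k * k.factorial * (1 / (b : ℝ)) ^ (k + 1) := by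
  rw [logTower, one_div, inv_pow, div_eq_mul_inv]

lemma digitZeta_eqMod {d s : ℕ} (n : ℕ) (hd : 0 < d) :
    EqMod (s + 1 + n) (fun b => digitZeta b d (s + 2)) fun b : ℕ =>
      (zetaValue (s + 2) - 1 / (d : ℝ) ^ (s + 2)) + ∑ k ∈ Finset.range (n + 1),
        ((-1) ^ (k + 1) * (s + k).factorial / (s + 1).factorial * (bernoulli k / k.factorial)) *
          (1 / (b : ℝ)) ^ (s + 1 + k) := by
  have hs : ((s + 1).factorial : ℝ) ≠ 0 := by exact_mod_cast Nat.factorial_ne_zero _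
  refine .of_abs_le (4 * (s + 1 + n).factorial / (s + 1).factorial)
    ((eventually_gt_atTop d).mono fun b hb => ?_)
  have hb0 : 0 < b := by omega
  have hb' : (b : ℝ) ≠ 0 := by exact_mod_cast hb0.ne'
  have h := abs_zetaValue_sub_sum_le (s := s + 1) n (Nat.succ_ne_zero s) hb0
  rw [← Finset.add_sum_erase _ _ (Finset.mem_Ico.2 ⟨hd, hb⟩)] at h
  change |_ * (_ - (_ + digitZeta b d (s + 2))) + _| ≤ _ at h
  have e : digitZeta b d (s + 2) - ((zetaValue (s + 2) - 1 / (d : ℝ) ^ (s + 2)) +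
      ∑ k ∈ Finset.range (n + 1),
        ((-1) ^ (k + 1) * (s + k).factorial / (s + 1).factorial * (bernoulli k / k.factorial)) *
          (1 / (b : ℝ)) ^ (s + 1 + k))
      = -((-1) ^ (s + 1) / (s + 1).factorial) * ((-1) ^ (s + 1) * (s + 1).factorial *
        (zetaValue (s + 1 + 1) - (1 / (d : ℝ) ^ (s + 1 + 1) + digitZeta b d (s + 2)))
        + ∑ k ∈ Finset.range (n + 1), logTower (s + 1 + k) b * (bernoulli k / k.factorial)) := by
    have h1 : ((-1 : ℝ)) ^ (s + 1) * (-1) ^ (s + 1) = 1 := by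
      rw [← mul_pow]; simp
    rw [mul_add, Finset.mul_sum]
    have h2 : ∀ k ∈ Finset.range (n + 1), -((-1) ^ (s + 1) / ((s + 1).factorial : ℝ)) *
        (logTower (s + 1 + k) b * (bernoulli k / k.factorial)) =
        -(((-1) ^ (k + 1) * (s + k).factorial / (s + 1).factorial *
          (bernoulli k / k.factorial)) * (1 / (b : ℝ)) ^ (s + 1 + k)) := by
      intro k _
      rw [show s + 1 + k = s + k + 1 by ring, logTower_succ_natCast]
      have h3 : ((-1 : ℝ)) ^ (s + 1) * (-1) ^ (s + k) = (-1) ^ (k + 1) := by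
        rw [← pow_add, show s + 1 + (s + k) = 2 * s + (k + 1) by ring, pow_add, pow_mul]
        simp
      rw [← h3]
      ring
    rw [Finset.sum_congr rfl h2, Finset.sum_neg_distrib]
    generalize ∑ k ∈ Finset.range (n + 1), ((-1 : ℝ) ^ (k + 1) * (s + k).factorial /
      (s + 1).factorial * (bernoulli k / k.factorial)) * (1 / (b : ℝ)) ^ (s + 1 + k) = S
    have h4 : -((-1) ^ (s + 1) / ((s + 1).factorial : ℝ)) * ((-1) ^ (s + 1) * (s + 1).factorial *
        (zetaValue (s + 1 + 1) - (1 / (d : ℝ) ^ (s + 1 + 1) + digitZeta b d (s + 2))))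
        = -(((-1) ^ (s + 1) * (-1) ^ (s + 1)) * ((s + 1).factorial / (s + 1).factorial) *
        (zetaValue (s + 1 + 1) - (1 / (d : ℝ) ^ (s + 1 + 1) + digitZeta b d (s + 2)))) := by
      ring
    rw [h4, h1, div_self hs]
    ring
  rw [e, abs_mul, abs_neg, abs_div, abs_pow, abs_neg, abs_one, one_pow,
    abs_of_nonneg (Nat.cast_nonneg _)]
  refine (mul_le_mul_of_nonneg_left h (by positivity)).trans (le_of_eq ?_)
  rw [one_div_pow]
  field_simp

lemma expands_digitZeta {d : ℕ} (hd : 0 < d) (N s : ℕ) :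
    Expands N fun b => digitZeta b d (s + 2) := by
  refine Expands.of_eqMod ?_ ((digitZeta_eqMod (s := s) N hd).mono (by omega))
  refine (Expands.const N _).add (Expands.sum fun k _ => Expands.const_mul _ ?_)
  have := ((Expands.const N 1).inv_pow_mul (s + 1 + k)).mono (Nat.le_add_right N _)
  simpa using this

/-- The endpoints b², b, (d + 1)b and db give the four terms; the factor b lowers b^(-(k+1)) to
b^(-k). -/
lemma mul_twoDigitCoeff_succ {b d : ℕ} (hd : 0 < d) (hdb : d < b) (k : ℕ) :
    b * (twoDigitCoeff b d (k + 1) / (k + 1).factorial)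
      = (-1) ^ k / (k + 1) * (1 / (b : ℝ)) ^ k *
        ((1 / (b : ℝ)) ^ (k + 1) - (1 + (1 / ((d : ℝ) + 1)) ^ (k + 1) - (1 / (d : ℝ)) ^ (k + 1))) := by
  have hb : (b : ℝ) ≠ 0 := by exact_mod_cast (by omega : b ≠ 0)
  have hd' : (d : ℝ) ≠ 0 := by exact_mod_cast hd.ne'
  have hd1 : (d : ℝ) + 1 ≠ 0 := by positivity
  have hk : (k : ℝ) + 1 ≠ 0 := by positivity
  have hkf : (k.factorial : ℝ) ≠ 0 := by exact_mod_cast Nat.factorial_ne_zero _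
  have e1 : ((d : ℝ) * b + b) = (d + 1) * b := by ring
  simp only [twoDigitCoeff, logTower_succ_natCast, Nat.factorial_succ]
  push_cast
  rw [e1]
  simp only [one_div, mul_inv, mul_pow]
  rw [pow_succ (b : ℝ)⁻¹ k]
  field_simp
  ring

lemma kempnerSum_eqMod {d : ℕ} (hd : 0 < d) (N : ℕ) :
    EqMod N (fun b : ℕ => kempnerSum b d
        - ((b : ℝ) * Real.log b - b * Real.log (1 + 1 / (d : ℝ))))
      fun b : ℕ => (∑ k ∈ Finset.range (N + 1), (-1) ^ k / ((k : ℝ) + 1) * ((1 / (b : ℝ)) ^ k *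
          (((1 / (b : ℝ)) ^ (k + 1)
            - (1 + (1 / ((d : ℝ) + 1)) ^ (k + 1) - (1 / (d : ℝ)) ^ (k + 1)))
          * kempnerMean b d (bernoulliFun (k + 1)))))
        - ∑ j ∈ Finset.range N, (-1) ^ (j + 1) * ((1 / (b : ℝ)) ^ (j + 1) *
          (digitZeta b d (j + 2) * kempnerMean b d (fun x => ((d : ℝ) + x) ^ (j + 1)))) := by
  refine .of_abs_le (8 * (N + 1).factorial + (d + 1) ^ (N + 1))
    ((eventually_gt_atTop d).mono fun b hb => ?_)
  refine le_trans (le_of_eq ?_) (kempnerSum_formula hd hb N)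
  rw [Finset.mul_sum]
  refine congrArg _ (congrArg₂ _ rfl (congrArg₂ _ ?_ ?_))
  · refine Finset.sum_congr rfl fun k _ => ?_
    rw [← mul_assoc (b : ℝ), mul_twoDigitCoeff_succ hd hb]
    ring
  · refine Finset.sum_congr rfl fun j _ => ?_
    rw [neg_pow]
    ring

lemma expands_kempnerSum {d : ℕ} (hd : 0 < d) (N : ℕ) :
    Expands N fun b : ℕ => kempnerSum b d
      - ((b : ℝ) * Real.log b - b * Real.log (1 + 1 / (d : ℝ))) := by
  have hX : ∀ k, Expands N fun b : ℕ => (1 / (b : ℝ)) ^ k := fun k => by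
    simpa using ((Expands.const N 1).inv_pow_mul k).mono (Nat.le_add_right N k)
  refine Expands.of_eqMod (Expands.sub ?_ ?_) (kempnerSum_eqMod hd N)
  · exact Expands.sum fun k _ => Expands.const_mul _ ((hX k).mul
      (((hX (k + 1)).sub (.const N _)).mul (expands_bernoulliFun d N (k + 1))))
  · exact Expands.sum fun j _ => Expands.const_mul _ ((hX (j + 1)).mul
      ((expands_digitZeta hd N j).mul (expands_shift_pow (expands_bernoulliFun d N) (j + 1))))

/-! Asymptotic expansions as formal power series. -/

/-- `p` is the asymptotic expansion of `f b` in powers of `1 / b`. -/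
def HasSeries (f : ℕ → ℝ) (p : PowerSeries ℝ) : Prop :=
  ∀ N, EqMod N f fun b : ℕ => (p.trunc N).eval (1 / (b : ℝ))

lemma EqMod.of_coeff_eq {N : ℕ} {p q : Polynomial ℝ} (h : ∀ i < N, p.coeff i = q.coeff i) :
    EqMod N (fun b : ℕ => p.eval (1 / (b : ℝ))) fun b : ℕ => q.eval (1 / (b : ℝ)) := by
  have e : ∀ b : ℕ, ∑ i ∈ Finset.range N, p.coeff i * (1 / (b : ℝ)) ^ i
      = ∑ i ∈ Finset.range N, q.coeff i * (1 / (b : ℝ)) ^ i := fun b =>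
    Finset.sum_congr rfl fun i hi => by rw [h i (Finset.mem_range.1 hi)]
  have h1 := eval_eqMod_trunc N p
  simp only [e] at h1
  exact h1.trans (eval_eqMod_trunc N q).symm

lemma coeff_eq_of_hasSeries {N : ℕ} {f g : ℕ → ℝ} {p q : PowerSeries ℝ} (hf : HasSeries f p)
    (hg : HasSeries g q) (h : EqMod N f g) {i : ℕ} (hi : i < N) : p.coeff i = q.coeff i := by
  have := coeff_eq_of_eqMod (((hf N).symm.trans h).trans (hg N)) i hi
  simpa [PowerSeries.coeff_trunc, hi] using this

lemma eq_of_hasSeries {f g : ℕ → ℝ} {p q : PowerSeries ℝ} (hf : HasSeries f p)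
    (hg : HasSeries g q) (h : ∀ᶠ b in atTop, f b = g b) : p = q :=
  PowerSeries.ext fun n =>
    coeff_eq_of_hasSeries hf hg (.of_eventuallyEq (n + 1) h) (Nat.lt_succ_self n)

lemma exists_hasSeries {f : ℕ → ℝ} (h : ∀ N, Expands N f) : ∃ p, HasSeries f p := by
  choose q hq using h
  -- By uniqueness, coefficient i is the same in every approximating polynomial of order above i;
  -- order i + 1 is the first that determines it.
  refine ⟨.mk fun i => (q (i + 1)).coeff i, fun N => (hq N).trans (.of_coeff_eq fun i hi => ?_)⟩
  rw [PowerSeries.coeff_trunc, if_pos hi, PowerSeries.coeff_mk]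
  exact coeff_eq_of_eqMod (((hq N).mono hi).symm.trans (hq (i + 1))) i (Nat.lt_succ_self i)

lemma hasSeries_const (c : ℝ) : HasSeries (fun _ => c) (PowerSeries.C c) := fun N => by
  have h : EqMod N (fun b : ℕ => (Polynomial.C c).eval (1 / (b : ℝ)))
      fun b : ℕ => ((PowerSeries.C c).trunc N).eval (1 / (b : ℝ)) := by
    refine .of_coeff_eq fun i hi => ?_
    rw [PowerSeries.coeff_trunc, if_pos hi, PowerSeries.coeff_C, Polynomial.coeff_C]
  simpa using h

lemma hasSeries_inv : HasSeries (fun b : ℕ => 1 / (b : ℝ)) PowerSeries.X := fun N => by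
  have h : EqMod N (fun b : ℕ => (Polynomial.X : Polynomial ℝ).eval (1 / (b : ℝ)))
      fun b : ℕ => ((PowerSeries.X : PowerSeries ℝ).trunc N).eval (1 / (b : ℝ)) := by
    refine .of_coeff_eq fun i hi => ?_
    rw [PowerSeries.coeff_trunc, if_pos hi, PowerSeries.coeff_X, Polynomial.coeff_X]
    simp [eq_comm]
  simpa using h

lemma HasSeries.add {f g : ℕ → ℝ} {p q : PowerSeries ℝ} (hf : HasSeries f p)
    (hg : HasSeries g q) : HasSeries (fun b => f b + g b) (p + q) := fun N => by
  simpa using (hf N).add (hg N)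

lemma HasSeries.mul {f g : ℕ → ℝ} {p q : PowerSeries ℝ} (hf : HasSeries f p)
    (hg : HasSeries g q) : HasSeries (fun b => f b * g b) (p * q) := fun N => by
  have hb : EqMod 0 f fun _ => 0 := ((hf N).mono N.zero_le).trans (.eval_inv_zero _)
  have h1 := (hf N).mul (hg N) hb (.eval_inv_zero _)
  refine h1.trans ?_
  have h2 : EqMod N (fun b : ℕ => (p.trunc N * q.trunc N).eval (1 / (b : ℝ)))
      fun b : ℕ => ((p * q).trunc N).eval (1 / (b : ℝ)) := by
    refine .of_coeff_eq fun i hi => ?_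
    rw [← PowerSeries.trunc_trunc_mul_trunc, PowerSeries.coeff_trunc, if_pos hi,
      ← Polynomial.coe_mul, Polynomial.coeff_coe]
  simpa using h2

lemma HasSeries.sub {f g : ℕ → ℝ} {p q : PowerSeries ℝ} (hf : HasSeries f p)
    (hg : HasSeries g q) : HasSeries (fun b => f b - g b) (p - q) := by
  have := hf.add ((hasSeries_const (-1)).mul hg)
  simpa [sub_eq_add_neg] using this

lemma HasSeries.pow {f : ℕ → ℝ} {p : PowerSeries ℝ} (hf : HasSeries f p) (k : ℕ) :
    HasSeries (fun b => f b ^ k) (p ^ k) := by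
  induction k with
  | zero => simpa using hasSeries_const 1
  | succ k ih => simpa only [pow_succ] using ih.mul hf

lemma HasSeries.sum {ι : Type*} {s : Finset ι} {f : ι → ℕ → ℝ} {p : ι → PowerSeries ℝ}
    (h : ∀ i ∈ s, HasSeries (f i) (p i)) :
    HasSeries (fun b => ∑ i ∈ s, f i b) (∑ i ∈ s, p i) := by
  classical
  induction s using Finset.induction_on with
  | empty => simpa using hasSeries_const 0
  | insert i s hi ih =>
    simp only [Finset.sum_insert hi]
    exact (h i (by simp)).add (ih fun j hj => h j (by simp [hj]))

lemma HasSeries.hasInversePowerExpansion {f : ℕ → ℝ} {p : PowerSeries ℝ} (h : HasSeries f p)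
    (h0 : p.coeff 0 = 0) : HasInversePowerExpansion f fun i => p.coeff i := by
  refine hasInversePowerExpansion_of_eqMod h0 fun N => ?_
  have h1 := (h N).trans (eval_eqMod_trunc N _)
  have e : ∀ b : ℕ, ∑ i ∈ Finset.range N, (p.trunc N).coeff i * (1 / (b : ℝ)) ^ i
      = ∑ i ∈ Finset.range N, p.coeff i * (1 / (b : ℝ)) ^ i := fun b =>
    Finset.sum_congr rfl fun i hi => by
      rw [PowerSeries.coeff_trunc, if_pos (Finset.mem_range.1 hi)]
  simpa only [e] using h1

/-! The series attached to the means. -/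

section
variable {d : ℕ} {W M Z : ℕ → PowerSeries ℝ}

lemma bernoulli_series_zero (hW : ∀ k, HasSeries (fun b => kempnerMean b d (bernoulliFun k)) (W k)) :
    W 0 = 1 := by
  refine eq_of_hasSeries (hW 0) (by simpa using hasSeries_const 1)
    ((eventually_gt_atTop d).mono fun _ hb => ?_)
  have hB0 : bernoulliFun 0 = fun _ => 1 := funext bernoulliFun_zero
  rw [hB0, kempnerMean_one hb]

lemma bernoulli_series_rec (hW : ∀ k, HasSeries (fun b => kempnerMean b d (bernoulliFun k)) (W k))
    (hM : ∀ j, HasSeries (fun b => kempnerMean b d fun x => ((d : ℝ) + x) ^ j) (M j)) (k : ℕ) :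
    W k = PowerSeries.X ^ k * W k - PowerSeries.X * ∑ i ∈ Finset.range k,
      PowerSeries.C (bernoulli i * k.choose i : ℝ) * (PowerSeries.X ^ (k - i) * M (k - i)) :=
  eq_of_hasSeries (hW k) (((hasSeries_inv.pow k).mul (hW k)).sub (hasSeries_inv.mul
    (HasSeries.sum fun i _ => (hasSeries_const _).mul ((hasSeries_inv.pow (k - i)).mul
      (hM (k - i))))))
    ((eventually_gt_atTop d).mono fun _ hb => kempnerMean_bernoulliFun hb k)

lemma moment_series_eq (hW : ∀ k, HasSeries (fun b => kempnerMean b d (bernoulliFun k)) (W k))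
    (hM : ∀ j, HasSeries (fun b => kempnerMean b d fun x => ((d : ℝ) + x) ^ j) (M j)) (j : ℕ) :
    M j = ∑ i ∈ Finset.range (j + 1), PowerSeries.C ((d : ℝ) ^ i * j.choose i) *
      ∑ k ∈ Finset.range (j - i + 1),
        PowerSeries.C ((j - i + 1).choose k / ((j - i : ℕ) + 1) : ℝ) * W k :=
  eq_of_hasSeries (hM j) (HasSeries.sum fun i _ => (hasSeries_const _).mul
    (HasSeries.sum fun k _ => (hasSeries_const _).mul (hW k)))
    ((eventually_gt_atTop d).mono fun _ hb => by
      rw [kempnerMean_shift_pow hb j]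
      exact Finset.sum_congr rfl fun i _ => by rw [kempnerMean_pow hb])

lemma coeff_digitZeta_series (hd : 0 < d)
    (hZ : ∀ s, HasSeries (fun b => digitZeta b d (s + 2)) (Z s)) (s n : ℕ) :
    (Z s).coeff n = (if n = 0 then zetaValue (s + 2) - 1 / (d : ℝ) ^ (s + 2) else 0)
      + ∑ k ∈ Finset.range (n + 1), if n = s + 1 + k then
        (-1) ^ (k + 1) * (s + k).factorial / (s + 1).factorial * ((bernoulli k : ℝ) / k.factorial)
        else 0 := by
  have h := coeff_eq_of_hasSeries (hZ s) ((hasSeries_const _).add (HasSeries.sum fun k _ =>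
    (hasSeries_const _).mul (hasSeries_inv.pow (s + 1 + k)))) (digitZeta_eqMod (s := s) n hd)
    (i := n) (by omega)
  rw [h, map_add, map_sum, PowerSeries.coeff_C]
  refine congrArg _ (Finset.sum_congr rfl fun k _ => ?_)
  rw [PowerSeries.coeff_C_mul, PowerSeries.coeff_X_pow, mul_ite, mul_one, mul_zero]

/-- For k ≥ 1 the right side uses only coefficients of index below n, so with `coeff_moment_series`
all coefficients are determined recursively in n, starting from W 0 = 1. -/
lemma coeff_bernoulli_series
    (hW : ∀ k, HasSeries (fun b => kempnerMean b d (bernoulliFun k)) (W k))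
    (hM : ∀ j, HasSeries (fun b => kempnerMean b d fun x => ((d : ℝ) + x) ^ j) (M j)) (k n : ℕ) :
    (W k).coeff n = (if k ≤ n then (W k).coeff (n - k) else 0)
      - ∑ i ∈ Finset.range k, (bernoulli i : ℝ) * k.choose i *
        if k - i + 1 ≤ n then (M (k - i)).coeff (n - (k - i + 1)) else 0 := by
  conv_lhs => rw [bernoulli_series_rec hW hM k]
  rw [map_sub, PowerSeries.coeff_X_pow_mul', Finset.mul_sum, map_sum]
  refine congrArg _ (Finset.sum_congr rfl fun i _ => ?_)
  rw [mul_left_comm, ← mul_assoc PowerSeries.X, ← pow_succ', PowerSeries.coeff_C_mul,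
    PowerSeries.coeff_X_pow_mul']

lemma coeff_moment_series
    (hW : ∀ k, HasSeries (fun b => kempnerMean b d (bernoulliFun k)) (W k))
    (hM : ∀ j, HasSeries (fun b => kempnerMean b d fun x => ((d : ℝ) + x) ^ j) (M j)) (j n : ℕ) :
    (M j).coeff n = ∑ i ∈ Finset.range (j + 1), ((d : ℝ) ^ i * j.choose i) *
      ∑ k ∈ Finset.range (j - i + 1), ((j - i + 1).choose k / ((j - i : ℕ) + 1) : ℝ) *
        (W k).coeff n := by
  rw [moment_series_eq hW hM j]
  simp only [map_sum, PowerSeries.coeff_C_mul]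

lemma coeff_kempner_series (hd : 0 < d)
    (hW : ∀ k, HasSeries (fun b => kempnerMean b d (bernoulliFun k)) (W k))
    (hM : ∀ j, HasSeries (fun b => kempnerMean b d fun x => ((d : ℝ) + x) ^ j) (M j))
    (hZ : ∀ s, HasSeries (fun b => digitZeta b d (s + 2)) (Z s)) {P : PowerSeries ℝ}
    (hP : HasSeries (fun b : ℕ => kempnerSum b d
        - ((b : ℝ) * Real.log b - b * Real.log (1 + 1 / (d : ℝ)))) P) {N n : ℕ} (hn : n < N) :
    P.coeff n = (∑ k ∈ Finset.range (N + 1), (-1) ^ k / ((k : ℝ) + 1) * if k ≤ n then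
        (if k + 1 ≤ n - k then (W (k + 1)).coeff (n - k - (k + 1)) else 0)
          - (1 + (1 / ((d : ℝ) + 1)) ^ (k + 1) - (1 / (d : ℝ)) ^ (k + 1)) *
            (W (k + 1)).coeff (n - k) else 0)
      - ∑ j ∈ Finset.range N, (-1) ^ (j + 1) * if j + 1 ≤ n then
        ∑ p ∈ Finset.HasAntidiagonal.antidiagonal (n - (j + 1)), (Z j).coeff p.1 * (M (j + 1)).coeff p.2 else 0 := by
  have h := coeff_eq_of_hasSeries hP
    ((HasSeries.sum fun k _ => (hasSeries_const _).mul ((hasSeries_inv.pow k).mul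
      (((hasSeries_inv.pow (k + 1)).sub (hasSeries_const _)).mul (hW (k + 1))))).sub
    (HasSeries.sum fun j _ => (hasSeries_const _).mul ((hasSeries_inv.pow (j + 1)).mul
      ((hZ j).mul (hM (j + 1)))))) (kempnerSum_eqMod hd N) hn
  rw [h, map_sub, map_sum, map_sum]
  refine congrArg₂ _ (Finset.sum_congr rfl fun k _ => ?_) (Finset.sum_congr rfl fun j _ => ?_)
  · rw [PowerSeries.coeff_C_mul, PowerSeries.coeff_X_pow_mul', sub_mul, map_sub,
      PowerSeries.coeff_X_pow_mul', PowerSeries.coeff_C_mul]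
  · rw [PowerSeries.coeff_C_mul, PowerSeries.coeff_X_pow_mul', PowerSeries.coeff_mul]

end

/-! ### Tables of the coefficients needed through order 5: W k at n for k + n ≤ 6, M j at n for j +
n ≤ 5. -/

section
variable {d : ℕ} {W M Z : ℕ → PowerSeries ℝ}

lemma bernoulli_four : bernoulli 4 = -1 / 30 := by
  rw [bernoulli_eq_bernoulli'_of_ne_one (by norm_num), bernoulli'_four]

lemma coeff_zero_mean_series
    (hW : ∀ k, HasSeries (fun b => kempnerMean b d (bernoulliFun k)) (W k))
    (hM : ∀ j, HasSeries (fun b => kempnerMean b d fun x => ((d : ℝ) + x) ^ j) (M j)) :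
    (W 1).coeff 0 = 0 ∧
    (W 2).coeff 0 = 0 ∧
    (W 3).coeff 0 = 0 ∧
    (W 4).coeff 0 = 0 ∧
    (W 5).coeff 0 = 0 ∧
    (W 6).coeff 0 = 0 ∧
    (M 1).coeff 0 = (d : ℝ) + 1 / 2 ∧
    (M 2).coeff 0 = (d : ℝ) ^ 2 + (d : ℝ) + 1 / 3 ∧
    (M 3).coeff 0 = (d : ℝ) ^ 3 + 3 / 2 * (d : ℝ) ^ 2 + (d : ℝ) + 1 / 4 ∧
    (M 4).coeff 0 = (d : ℝ) ^ 4 + 2 * (d : ℝ) ^ 3 + 2 * (d : ℝ) ^ 2 + (d : ℝ) + 1 / 5 ∧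
    (M 5).coeff 0 = (d : ℝ) ^ 5 + 5 / 2 * (d : ℝ) ^ 4 + 10 / 3 * (d : ℝ) ^ 3 + 5 / 2 * (d : ℝ) ^ 2 + (d : ℝ) + 1 / 6 := by
  have hw := coeff_bernoulli_series hW hM
  have hm := coeff_moment_series hW hM
  have h0 := bernoulli_series_zero hW
  have w10 : (W 1).coeff 0 = 0 := by
    rw [hw 1 0]
    norm_num [Finset.sum_range_succ, Nat.choose, h0, PowerSeries.coeff_one, bernoulli_four,
      -PowerSeries.coeff_zero_eq_constantCoeff]
  have w20 : (W 2).coeff 0 = 0 := by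
    rw [hw 2 0]
    norm_num [Finset.sum_range_succ, Nat.choose, h0, PowerSeries.coeff_one, bernoulli_four,
      -PowerSeries.coeff_zero_eq_constantCoeff]
  have w30 : (W 3).coeff 0 = 0 := by
    rw [hw 3 0]
    norm_num [Finset.sum_range_succ, Nat.choose, h0, PowerSeries.coeff_one, bernoulli_four,
      -PowerSeries.coeff_zero_eq_constantCoeff]
  have w40 : (W 4).coeff 0 = 0 := by
    rw [hw 4 0]
    norm_num [Finset.sum_range_succ, Nat.choose, h0, PowerSeries.coeff_one, bernoulli_four,
      -PowerSeries.coeff_zero_eq_constantCoeff]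
  have w50 : (W 5).coeff 0 = 0 := by
    rw [hw 5 0]
    norm_num [Finset.sum_range_succ, Nat.choose, h0, PowerSeries.coeff_one, bernoulli_four,
      -PowerSeries.coeff_zero_eq_constantCoeff]
  have w60 : (W 6).coeff 0 = 0 := by
    rw [hw 6 0]
    norm_num [Finset.sum_range_succ, Nat.choose, h0, PowerSeries.coeff_one, bernoulli_four,
      -PowerSeries.coeff_zero_eq_constantCoeff]
  have m10 : (M 1).coeff 0 = (d : ℝ) + 1 / 2 := by
    rw [hm 1 0]
    norm_num [Finset.sum_range_succ, Nat.choose, h0, PowerSeries.coeff_one, bernoulli_four,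
      -PowerSeries.coeff_zero_eq_constantCoeff,
      w10]
    ring
  have m20 : (M 2).coeff 0 = (d : ℝ) ^ 2 + (d : ℝ) + 1 / 3 := by
    rw [hm 2 0]
    norm_num [Finset.sum_range_succ, Nat.choose, h0, PowerSeries.coeff_one, bernoulli_four,
      -PowerSeries.coeff_zero_eq_constantCoeff,
      w10, w20]
    ring
  have m30 : (M 3).coeff 0 = (d : ℝ) ^ 3 + 3 / 2 * (d : ℝ) ^ 2 + (d : ℝ) + 1 / 4 := by
    rw [hm 3 0]
    norm_num [Finset.sum_range_succ, Nat.choose, h0, PowerSeries.coeff_one, bernoulli_four,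
      -PowerSeries.coeff_zero_eq_constantCoeff,
      w10, w20, w30]
    ring
  have m40 : (M 4).coeff 0 = (d : ℝ) ^ 4 + 2 * (d : ℝ) ^ 3 + 2 * (d : ℝ) ^ 2 + (d : ℝ) + 1 / 5 := by
    rw [hm 4 0]
    norm_num [Finset.sum_range_succ, Nat.choose, h0, PowerSeries.coeff_one, bernoulli_four,
      -PowerSeries.coeff_zero_eq_constantCoeff,
      w10, w20, w30, w40]
    ring
  have m50 : (M 5).coeff 0 = (d : ℝ) ^ 5 + 5 / 2 * (d : ℝ) ^ 4 + 10 / 3 * (d : ℝ) ^ 3 + 5 / 2 * (d : ℝ) ^ 2 + (d : ℝ) + 1 / 6 := by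
    rw [hm 5 0]
    norm_num [Finset.sum_range_succ, Nat.choose, h0, PowerSeries.coeff_one, bernoulli_four,
      -PowerSeries.coeff_zero_eq_constantCoeff,
      w10, w20, w30, w40, w50]
    ring
  exact ⟨w10, w20, w30, w40, w50, w60, m10, m20, m30, m40, m50⟩

lemma coeff_one_mean_series
    (hW : ∀ k, HasSeries (fun b => kempnerMean b d (bernoulliFun k)) (W k))
    (hM : ∀ j, HasSeries (fun b => kempnerMean b d fun x => ((d : ℝ) + x) ^ j) (M j)) :
    (W 1).coeff 1 = 0 ∧
    (W 2).coeff 1 = 0 ∧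
    (W 3).coeff 1 = 0 ∧
    (W 4).coeff 1 = 0 ∧
    (W 5).coeff 1 = 0 ∧
    (M 1).coeff 1 = 0 ∧
    (M 2).coeff 1 = 0 ∧
    (M 3).coeff 1 = 0 ∧
    (M 4).coeff 1 = 0 := by
  have hw := coeff_bernoulli_series hW hM
  have hm := coeff_moment_series hW hM
  have h0 := bernoulli_series_zero hW
  obtain ⟨w10, w20, w30, w40, w50, w60, m10, m20, m30, m40, m50⟩ := coeff_zero_mean_series hW hM
  have w11 : (W 1).coeff 1 = 0 := by
    rw [hw 1 1]
    norm_num [Finset.sum_range_succ, Nat.choose, h0, PowerSeries.coeff_one, bernoulli_four,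
      -PowerSeries.coeff_zero_eq_constantCoeff,
      w10]
  have w21 : (W 2).coeff 1 = 0 := by
    rw [hw 2 1]
    norm_num [Finset.sum_range_succ, Nat.choose, h0, PowerSeries.coeff_one, bernoulli_four,
      -PowerSeries.coeff_zero_eq_constantCoeff]
  have w31 : (W 3).coeff 1 = 0 := by
    rw [hw 3 1]
    norm_num [Finset.sum_range_succ, Nat.choose, h0, PowerSeries.coeff_one, bernoulli_four,
      -PowerSeries.coeff_zero_eq_constantCoeff]
  have w41 : (W 4).coeff 1 = 0 := by
    rw [hw 4 1]
    norm_num [Finset.sum_range_succ, Nat.choose, h0, PowerSeries.coeff_one, bernoulli_four,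
      -PowerSeries.coeff_zero_eq_constantCoeff]
  have w51 : (W 5).coeff 1 = 0 := by
    rw [hw 5 1]
    norm_num [Finset.sum_range_succ, Nat.choose, h0, PowerSeries.coeff_one, bernoulli_four,
      -PowerSeries.coeff_zero_eq_constantCoeff]
  have m11 : (M 1).coeff 1 = 0 := by
    rw [hm 1 1]
    norm_num [Finset.sum_range_succ, Nat.choose, h0, PowerSeries.coeff_one, bernoulli_four,
      -PowerSeries.coeff_zero_eq_constantCoeff,
      w11]
  have m21 : (M 2).coeff 1 = 0 := by
    rw [hm 2 1]
    norm_num [Finset.sum_range_succ, Nat.choose, h0, PowerSeries.coeff_one, bernoulli_four,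
      -PowerSeries.coeff_zero_eq_constantCoeff,
      w11, w21]
  have m31 : (M 3).coeff 1 = 0 := by
    rw [hm 3 1]
    norm_num [Finset.sum_range_succ, Nat.choose, h0, PowerSeries.coeff_one, bernoulli_four,
      -PowerSeries.coeff_zero_eq_constantCoeff,
      w11, w21, w31]
  have m41 : (M 4).coeff 1 = 0 := by
    rw [hm 4 1]
    norm_num [Finset.sum_range_succ, Nat.choose, h0, PowerSeries.coeff_one, bernoulli_four,
      -PowerSeries.coeff_zero_eq_constantCoeff,
      w11, w21, w31, w41]
  exact ⟨w11, w21, w31, w41, w51, m11, m21, m31, m41⟩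

lemma coeff_two_mean_series
    (hW : ∀ k, HasSeries (fun b => kempnerMean b d (bernoulliFun k)) (W k))
    (hM : ∀ j, HasSeries (fun b => kempnerMean b d fun x => ((d : ℝ) + x) ^ j) (M j)) :
    (W 1).coeff 2 = -(d : ℝ) - 1 / 2 ∧
    (W 2).coeff 2 = (d : ℝ) + 1 / 2 ∧
    (W 3).coeff 2 = -1 / 2 * (d : ℝ) - 1 / 4 ∧
    (W 4).coeff 2 = 0 ∧
    (M 1).coeff 2 = -(d : ℝ) - 1 / 2 ∧
    (M 2).coeff 2 = -2 * (d : ℝ) ^ 2 - (d : ℝ) ∧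
    (M 3).coeff 2 = -3 * (d : ℝ) ^ 3 - 3 / 2 * (d : ℝ) ^ 2 := by
  have hw := coeff_bernoulli_series hW hM
  have hm := coeff_moment_series hW hM
  have h0 := bernoulli_series_zero hW
  obtain ⟨w10, w20, w30, w40, w50, w60, m10, m20, m30, m40, m50⟩ := coeff_zero_mean_series hW hM
  obtain ⟨w11, w21, w31, w41, w51, m11, m21, m31, m41⟩ := coeff_one_mean_series hW hM
  have w12 : (W 1).coeff 2 = -(d : ℝ) - 1 / 2 := by
    rw [hw 1 2]
    norm_num [Finset.sum_range_succ, Nat.choose, h0, PowerSeries.coeff_one, bernoulli_four,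
      -PowerSeries.coeff_zero_eq_constantCoeff,
      w11, m10]
    ring
  have w22 : (W 2).coeff 2 = (d : ℝ) + 1 / 2 := by
    rw [hw 2 2]
    norm_num [Finset.sum_range_succ, Nat.choose, h0, PowerSeries.coeff_one, bernoulli_four,
      -PowerSeries.coeff_zero_eq_constantCoeff,
      w20, m10]
  have w32 : (W 3).coeff 2 = -1 / 2 * (d : ℝ) - 1 / 4 := by
    rw [hw 3 2]
    norm_num [Finset.sum_range_succ, Nat.choose, h0, PowerSeries.coeff_one, bernoulli_four,
      -PowerSeries.coeff_zero_eq_constantCoeff,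
      m10]
    ring
  have w42 : (W 4).coeff 2 = 0 := by
    rw [hw 4 2]
    norm_num [Finset.sum_range_succ, Nat.choose, h0, PowerSeries.coeff_one, bernoulli_four,
      -PowerSeries.coeff_zero_eq_constantCoeff]
  have m12 : (M 1).coeff 2 = -(d : ℝ) - 1 / 2 := by
    rw [hm 1 2]
    norm_num [Finset.sum_range_succ, Nat.choose, h0, PowerSeries.coeff_one, bernoulli_four,
      -PowerSeries.coeff_zero_eq_constantCoeff,
      w12]
  have m22 : (M 2).coeff 2 = -2 * (d : ℝ) ^ 2 - (d : ℝ) := by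
    rw [hm 2 2]
    norm_num [Finset.sum_range_succ, Nat.choose, h0, PowerSeries.coeff_one, bernoulli_four,
      -PowerSeries.coeff_zero_eq_constantCoeff,
      w12, w22]
    ring
  have m32 : (M 3).coeff 2 = -3 * (d : ℝ) ^ 3 - 3 / 2 * (d : ℝ) ^ 2 := by
    rw [hm 3 2]
    norm_num [Finset.sum_range_succ, Nat.choose, h0, PowerSeries.coeff_one, bernoulli_four,
      -PowerSeries.coeff_zero_eq_constantCoeff,
      w12, w22, w32]
    ring
  exact ⟨w12, w22, w32, w42, m12, m22, m32⟩

lemma coeff_three_mean_series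
    (hW : ∀ k, HasSeries (fun b => kempnerMean b d (bernoulliFun k)) (W k))
    (hM : ∀ j, HasSeries (fun b => kempnerMean b d fun x => ((d : ℝ) + x) ^ j) (M j)) :
    (W 1).coeff 3 = -(d : ℝ) - 1 / 2 ∧
    (W 2).coeff 3 = -(d : ℝ) ^ 2 - (d : ℝ) - 1 / 3 ∧
    (W 3).coeff 3 = 3 / 2 * (d : ℝ) ^ 2 + 3 / 2 * (d : ℝ) + 1 / 2 ∧
    (M 1).coeff 3 = -(d : ℝ) - 1 / 2 ∧
    (M 2).coeff 3 = -3 * (d : ℝ) ^ 2 - 3 * (d : ℝ) - 5 / 6 := by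
  have hw := coeff_bernoulli_series hW hM
  have hm := coeff_moment_series hW hM
  have h0 := bernoulli_series_zero hW
  obtain ⟨w10, w20, w30, w40, w50, w60, m10, m20, m30, m40, m50⟩ := coeff_zero_mean_series hW hM
  obtain ⟨w11, w21, w31, w41, w51, m11, m21, m31, m41⟩ := coeff_one_mean_series hW hM
  obtain ⟨w12, w22, w32, w42, m12, m22, m32⟩ := coeff_two_mean_series hW hM
  have w13 : (W 1).coeff 3 = -(d : ℝ) - 1 / 2 := by
    rw [hw 1 3]
    norm_num [Finset.sum_range_succ, Nat.choose, h0, PowerSeries.coeff_one, bernoulli_four,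
      -PowerSeries.coeff_zero_eq_constantCoeff,
      w12, m11]
  have w23 : (W 2).coeff 3 = -(d : ℝ) ^ 2 - (d : ℝ) - 1 / 3 := by
    rw [hw 2 3]
    norm_num [Finset.sum_range_succ, Nat.choose, h0, PowerSeries.coeff_one, bernoulli_four,
      -PowerSeries.coeff_zero_eq_constantCoeff,
      w21, m20, m11]
    ring
  have w33 : (W 3).coeff 3 = 3 / 2 * (d : ℝ) ^ 2 + 3 / 2 * (d : ℝ) + 1 / 2 := by
    rw [hw 3 3]
    norm_num [Finset.sum_range_succ, Nat.choose, h0, PowerSeries.coeff_one, bernoulli_four,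
      -PowerSeries.coeff_zero_eq_constantCoeff,
      w30, m20, m11]
    ring
  have m13 : (M 1).coeff 3 = -(d : ℝ) - 1 / 2 := by
    rw [hm 1 3]
    norm_num [Finset.sum_range_succ, Nat.choose, h0, PowerSeries.coeff_one, bernoulli_four,
      -PowerSeries.coeff_zero_eq_constantCoeff,
      w13]
  have m23 : (M 2).coeff 3 = -3 * (d : ℝ) ^ 2 - 3 * (d : ℝ) - 5 / 6 := by
    rw [hm 2 3]
    norm_num [Finset.sum_range_succ, Nat.choose, h0, PowerSeries.coeff_one, bernoulli_four,
      -PowerSeries.coeff_zero_eq_constantCoeff,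
      w13, w23]
    ring
  exact ⟨w13, w23, w33, m13, m23⟩

lemma coeff_four_mean_series
    (hW : ∀ k, HasSeries (fun b => kempnerMean b d (bernoulliFun k)) (W k))
    (hM : ∀ j, HasSeries (fun b => kempnerMean b d fun x => ((d : ℝ) + x) ^ j) (M j)) :
    (W 1).coeff 4 = 0 ∧
    (W 2).coeff 4 = 0 ∧
    (M 1).coeff 4 = 0 := by
  have hw := coeff_bernoulli_series hW hM
  have hm := coeff_moment_series hW hM
  have h0 := bernoulli_series_zero hW
  obtain ⟨w10, w20, w30, w40, w50, w60, m10, m20, m30, m40, m50⟩ := coeff_zero_mean_series hW hM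
  obtain ⟨w11, w21, w31, w41, w51, m11, m21, m31, m41⟩ := coeff_one_mean_series hW hM
  obtain ⟨w12, w22, w32, w42, m12, m22, m32⟩ := coeff_two_mean_series hW hM
  obtain ⟨w13, w23, w33, m13, m23⟩ := coeff_three_mean_series hW hM
  have w14 : (W 1).coeff 4 = 0 := by
    rw [hw 1 4]
    norm_num [Finset.sum_range_succ, Nat.choose, h0, PowerSeries.coeff_one, bernoulli_four,
      -PowerSeries.coeff_zero_eq_constantCoeff,
      w13, m12]
  have w24 : (W 2).coeff 4 = 0 := by
    rw [hw 2 4]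
    norm_num [Finset.sum_range_succ, Nat.choose, h0, PowerSeries.coeff_one, bernoulli_four,
      -PowerSeries.coeff_zero_eq_constantCoeff,
      w22, m21, m12]
    ring
  have m14 : (M 1).coeff 4 = 0 := by
    rw [hm 1 4]
    norm_num [Finset.sum_range_succ, Nat.choose, h0, PowerSeries.coeff_one, bernoulli_four,
      -PowerSeries.coeff_zero_eq_constantCoeff,
      w14]
  exact ⟨w14, w24, m14⟩

lemma coeff_five_mean_series
    (hW : ∀ k, HasSeries (fun b => kempnerMean b d (bernoulliFun k)) (W k))
    (hM : ∀ j, HasSeries (fun b => kempnerMean b d fun x => ((d : ℝ) + x) ^ j) (M j)) :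
    (W 1).coeff 5 = (d : ℝ) + 1 / 2 := by
  have hw := coeff_bernoulli_series hW hM
  have hm := coeff_moment_series hW hM
  have h0 := bernoulli_series_zero hW
  obtain ⟨w10, w20, w30, w40, w50, w60, m10, m20, m30, m40, m50⟩ := coeff_zero_mean_series hW hM
  obtain ⟨w11, w21, w31, w41, w51, m11, m21, m31, m41⟩ := coeff_one_mean_series hW hM
  obtain ⟨w12, w22, w32, w42, m12, m22, m32⟩ := coeff_two_mean_series hW hM
  obtain ⟨w13, w23, w33, m13, m23⟩ := coeff_three_mean_series hW hM
  obtain ⟨w14, w24, m14⟩ := coeff_four_mean_series hW hM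
  have w15 : (W 1).coeff 5 = (d : ℝ) + 1 / 2 := by
    rw [hw 1 5]
    norm_num [Finset.sum_range_succ, Nat.choose, h0, PowerSeries.coeff_one, bernoulli_four,
      -PowerSeries.coeff_zero_eq_constantCoeff,
      w14, m13]
    ring
  exact w15

lemma coeff_digitZeta_series_table (hd : 0 < d)
    (hZ : ∀ s, HasSeries (fun b => digitZeta b d (s + 2)) (Z s)) :
    (Z 0).coeff 0 = zetaValue 2 - 1 / (d : ℝ) ^ 2 ∧
    (Z 0).coeff 1 = -1 ∧
    (Z 0).coeff 2 = -1 / 2 ∧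
    (Z 0).coeff 3 = -1 / 6 ∧
    (Z 0).coeff 4 = 0 ∧
    (Z 1).coeff 0 = zetaValue 3 - 1 / (d : ℝ) ^ 3 ∧
    (Z 1).coeff 1 = 0 ∧
    (Z 1).coeff 2 = -1 / 2 ∧
    (Z 1).coeff 3 = -1 / 2 ∧
    (Z 2).coeff 0 = zetaValue 4 - 1 / (d : ℝ) ^ 4 ∧
    (Z 2).coeff 1 = 0 ∧
    (Z 2).coeff 2 = 0 ∧
    (Z 3).coeff 0 = zetaValue 5 - 1 / (d : ℝ) ^ 5 ∧
    (Z 3).coeff 1 = 0 ∧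
    (Z 4).coeff 0 = zetaValue 6 - 1 / (d : ℝ) ^ 6 := by
  have hz := coeff_digitZeta_series hd hZ
  refine ⟨?_, ?_, ?_, ?_, ?_, ?_, ?_, ?_, ?_, ?_, ?_, ?_, ?_, ?_, ?_⟩ <;>
    · rw [hz]
      norm_num [Finset.sum_range_succ, Nat.factorial, bernoulli_four]

end

theorem mainTheorem4 (d : ℕ) (hd : 0 < d) :
    (∀ b : ℕ, d < b → Summable (fun m : kempnerSet b d => 1 / ((m : ℕ) : ℝ))) ∧
    ∃ a : ℕ → ℝ,
      HasInversePowerExpansion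
        (fun b : ℕ => kempnerSum b d
          - ((b : ℝ) * Real.log (b : ℝ) - (b : ℝ) * Real.log (1 + 1 / (d : ℝ)))) a ∧
      a 1 = ((d : ℝ) + 1 / 2) * (zetaValue 2 - 1 / (d : ℝ) ^ 2) ∧
      a 2 = -((d : ℝ) ^ 2 + d + 1 / 3) * zetaValue 3
        + (9 * (d : ℝ) ^ 2 + 8 * d + 2) / (6 * (d : ℝ) ^ 3 * ((d : ℝ) + 1)) ∧
      a 3 = ((d : ℝ) + 1 / 2) * ((d : ℝ) ^ 2 + d + 1 / 2) * zetaValue 4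
        - ((d : ℝ) + 1 / 2) * zetaValue 2
        - ((d : ℝ) + 1 / 2)
          * ((2 * (d : ℝ) ^ 4 + 6 * (d : ℝ) ^ 3 + 6 * (d : ℝ) ^ 2 + 4 * d + 1)
            / (2 * (d : ℝ) ^ 4 * ((d : ℝ) + 1) ^ 2)) ∧
      a 4 = -((d : ℝ) ^ 4 + 2 * (d : ℝ) ^ 3 + 2 * (d : ℝ) ^ 2 + d + 1 / 5) * zetaValue 5
        + (2 * (d : ℝ) + 1) * d * zetaValue 3
        - ((d : ℝ) + 1 / 2) * zetaValue 2
        + (60 * (d : ℝ) ^ 7 + 240 * (d : ℝ) ^ 6 + 500 * (d : ℝ) ^ 5 + 705 * (d : ℝ) ^ 4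
            + 627 * (d : ℝ) ^ 3 + 331 * (d : ℝ) ^ 2 + 96 * d + 12)
          / (60 * (d : ℝ) ^ 5 * ((d : ℝ) + 1) ^ 3) ∧
      a 5 = ((d : ℝ) + 1 / 2) * ((d : ℝ) ^ 2 + d + 1) * ((d : ℝ) ^ 2 + d + 1 / 3) * zetaValue 6
        - 3 * ((d : ℝ) + 1 / 2) * (d : ℝ) ^ 2 * zetaValue 4
        + (3 * (d : ℝ) ^ 2 + 3 * d + 5 / 6) * zetaValue 3
        - ((d : ℝ) + 1 / 2)
          * ((9 * (d : ℝ) ^ 6 + 38 * (d : ℝ) ^ 5 + 56 * (d : ℝ) ^ 4 + 44 * (d : ℝ) ^ 3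
              + 22 * (d : ℝ) ^ 2 + 7 * d + 1)
            / (3 * (d : ℝ) ^ 6 * ((d : ℝ) + 1) ^ 3)) := by
  refine ⟨fun b hb => (hasSum_kempner hd hb).summable, ?_⟩
  have hW0 := expands_bernoulliFun d
  choose W hW using fun k => exists_hasSeries fun N => hW0 N k
  choose M hM using fun j => exists_hasSeries fun N => expands_shift_pow (hW0 N) j
  choose Z hZ using fun s => exists_hasSeries fun N => expands_digitZeta hd N s
  obtain ⟨P, hP⟩ := exists_hasSeries (expands_kempnerSum hd)
  -- Truncation at order 6 determines the coefficients of index 0 to 5.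
  have hc := fun {n : ℕ} (hn : n < 6) => coeff_kempner_series hd hW hM hZ hP hn
  have h0 := coeff_zero_mean_series hW hM
  have h1 := coeff_one_mean_series hW hM
  have h2 := coeff_two_mean_series hW hM
  have h3 := coeff_three_mean_series hW hM
  have h4 := coeff_four_mean_series hW hM
  have h5 := coeff_five_mean_series hW hM
  have hz := coeff_digitZeta_series_table hd hZ
  have hd0 : (d : ℝ) ≠ 0 := by exact_mod_cast hd.ne'
  have hd1 : (d : ℝ) + 1 ≠ 0 := by positivity
  refine ⟨fun i => P.coeff i, hP.hasInversePowerExpansion ?_, ?_, ?_, ?_, ?_, ?_⟩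
  -- The expansion has no constant term: the only candidate is a multiple of the constant
  -- coefficient of W 1, which is 0.
  · refine (hc (by norm_num : 0 < 6)).trans ?_
    norm_num [Finset.sum_range_succ, Finset.Nat.sum_antidiagonal_eq_sum_range_succ_mk,
      -PowerSeries.coeff_zero_eq_constantCoeff, -one_div, h0, h1, h2, h3, h4, h5, hz]
  · refine (hc (by norm_num : 1 < 6)).trans ?_
    norm_num [Finset.sum_range_succ, Finset.Nat.sum_antidiagonal_eq_sum_range_succ_mk,
      -PowerSeries.coeff_zero_eq_constantCoeff, -one_div, h0, h1, h2, h3, h4, h5, hz]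
    field_simp
  · refine (hc (by norm_num : 2 < 6)).trans ?_
    norm_num [Finset.sum_range_succ, Finset.Nat.sum_antidiagonal_eq_sum_range_succ_mk,
      -PowerSeries.coeff_zero_eq_constantCoeff, -one_div, h0, h1, h2, h3, h4, h5, hz]
    field_simp
    ring
  · refine (hc (by norm_num : 3 < 6)).trans ?_
    norm_num [Finset.sum_range_succ, Finset.Nat.sum_antidiagonal_eq_sum_range_succ_mk,
      -PowerSeries.coeff_zero_eq_constantCoeff, -one_div, h0, h1, h2, h3, h4, h5, hz]
    field_simp
    ring
  · refine (hc (by norm_num : 4 < 6)).trans ?_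
    norm_num [Finset.sum_range_succ, Finset.Nat.sum_antidiagonal_eq_sum_range_succ_mk,
      -PowerSeries.coeff_zero_eq_constantCoeff, -one_div, h0, h1, h2, h3, h4, h5, hz]
    field_simp
    ring
  · refine (hc (by norm_num : 5 < 6)).trans ?_
    norm_num [Finset.sum_range_succ, Finset.Nat.sum_antidiagonal_eq_sum_range_succ_mk,
      -PowerSeries.coeff_zero_eq_constantCoeff, -one_div, h0, h1, h2, h3, h4, h5, hz]
    field_simp
    ring
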